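/- **Model.** $n$ robots are points of the Euclidean plane. Each robot has its own unit of length and its own orthonormal axes (of arbitrary direction and orientation), and observes the set $P$ of all occupied positions in its own coordinates, itself at the origin. All robots run the same program, a function from the observed set to a destination in the robot's own coordinates (no identities, no memory). At each instant $t=0,1,2,\dots$ a nonempty set of robots is active; active robots move to their computed destinations simultaneously, all others stay. The scheduler is fair: every robot is active infinitely often. A program *solves circle formation for $n$ robots* if, for all choices of axes and units, all fair schedulers and all initial configurations of $n$ distinct positions, there is an instant at which the robots form a non-degenerate regular $n$-gon, and from then on no robot moves. It *places the robots on a circle* if, under the same conditions, there is an instant at which the robots are at distinct positions on a non-degenerate circle. **Leader.** Let the robots be at $n$ distinct points of a circle $C$ with centre $O$. The string of angles of a robot $r$ is the word of length $n$ of the angles $\widehat{xOx'}$ (between half-lines) over the successive pairs of neighbours $x,x'$ when $C$ is traversed once clockwise from $r$; traversing counterclockwise gives a second word. A Lyndon word is a nonempty word lexicographically strictly smaller than all its nontrivial rotations. Let $LWS$ be the set of robots for which at least one of the two words is Lyndon. If $LWS=\{r_a,r_b\}$ with $r_a\ne r_b$, the half-lines $[O,r_a)$, $[O,r_b)$ cut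 $C$ into two sides. The leader is the median robot of the side that contains an odd number of robots other than $r_a,r_b$. **Oriented configuration.** The $n$ positions are distinct, all but one of them, $r_{\mathtt O}$, lie on a non-degenerate circle $C_{\mathtt O}$ with centre $O$; $r_{\mathtt O}$ is inside $C_{\mathtt O}$, $r_{\mathtt O}\neq O$, and no robot is at $p_1:=C_{\mathtt O}\cap[O,r_{\mathtt O})$. The final positions are the vertices $p_1,\dots,p_n$ of the regular $n$-gon inscribed in $C_{\mathtt O}$ with vertex $p_1$. A robot other than $r_{\mathtt O}$ is free if it is not at a final position; a position $p_k$, $k\ge2$, is free if no robot is there. **Procedure $\phi_{\mathtt O}$** (oriented configurations). If no robot is free, $r_{\mathtt O}$ moves to $p_1$ and the others stay. Otherwise, the free robot closest to $p_1$ clockwise moves to the free position closest to $p_1$ clockwise, the free robot closest to $p_1$ counterclockwise moves to the free position closest to $p_1$ counterclockwise, and all others stay (if there is only one free robot, it moves to the only free position). **Algorithm $\phi_{n\text{-gon}}[\psi]$**, with a procedure $\psi$ for placing the robots on a circle. If the robots form a regular $n$-gon, stay. Otherwise, if the configuration is oriented, execute $\phi_{\mathtt O}$. Otherwise, if the robots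 are at $n$ distinct points of a non-degenerate circle with centre $O$, the leader $r$ moves to the midpoint of $[O,r]$ and the others stay. Otherwise, execute $\psi$. **Procedure $\phi_{circle}$.** Let $C$ be the smallest circle enclosing all robots. A robot on $C$ stays. A robot $r$ strictly inside $C$ considers in turn the point of $C$ on the half-line from the centre through $r$ (in the direction of its own first axis, if $r$ is at the centre), and that point rotated about the centre by the angles $1,\frac12,\frac13,\dots$ (counterclockwise in its own coordinates). It moves to the first of these points that is unoccupied and strictly closer to $r$ than to every other robot strictly inside $C$; if there is none it stays. **Theorem.** Let $n\ge5$ be prime. Then $\phi_{n\text{-gon}}[\phi_{circle}]$ solves circle formation for $n$ robots. Moreover, for every program $\psi$ that places $n$ robots on a circle, $\phi_{n\text{-gon}}[\psi]$ solves circle formation for $n$ robots. -/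

import Mathlib

open scoped Classical

noncomputable section

namespace CircleFormation

open EuclideanGeometry

/-! ### The distributed model -/

/-- The Euclidean plane in which the robots move. -/
abbrev Plane : Type := ℂ

/-- The axes and the unit of length of a robot. The axes are given by a linear isometry, which may
reverse the orientation: robots share neither directions, nor chirality, nor the unit. -/
structure Frame where
  unit : ℝ
  unit_pos : 0 < unit
  axes : Plane ≃ₗᵢ[ℝ] Plane

/-- Coordinates of the point `x` for a robot that has the frame `F` and stands at `p`.
The robot itself is at the origin of its coordinate system. -/
def Frame.toLocal (F : Frame) (p x : Plane) : Plane := F.unit • F.axes (x - p)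

/-- The point with local coordinates `y` for a robot that has the frame `F` and stands at `p`. -/
def Frame.ofLocal (F : Frame) (p y : Plane) : Plane := p + F.axes.symm (F.unit⁻¹ • y)

/-- The program of an anonymous, oblivious robot: from the set of the positions that are occupied
now, in its own coordinates (itself at `0`), it computes a destination in its own coordinates. -/
abbrev Program : Type := Finset Plane → Plane

/-- The set of positions occupied by the robots. -/
def occupied {n : ℕ} (pos : Fin n → Plane) : Finset Plane := Finset.univ.image pos

/-- One computation step, in which exactly the robots in `S` are active. -/
def step {n : ℕ} (A : Program) (F : Fin n → Frame) (S : Finset (Fin n)) (pos : Fin n → Plane) :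
    Fin n → Plane := fun i =>
  if i ∈ S then
    (F i).ofLocal (pos i) (A ((occupied pos).image ((F i).toLocal (pos i))))
  else pos i

/-- Positions of the robots at the successive instants. -/
def run {n : ℕ} (A : Program) (F : Fin n → Frame) (sched : ℕ → Finset (Fin n))
    (init : Fin n → Plane) : ℕ → Fin n → Plane
  | 0 => init
  | t + 1 => step A F (sched t) (run A F sched init t)

/-- A fair scheduler: at every instant some robot is active, and every robot is active
infinitely often. -/
def IsFair {n : ℕ} (sched : ℕ → Finset (Fin n)) : Prop :=
  (∀ t, (sched t).Nonempty) ∧ ∀ i t, ∃ s, t ≤ s ∧ i ∈ sched s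

/-! ### Points on a circle -/

/-- The clockwise angle, in `(0, 2π]`, from the half-line `[O, p)` to the half-line `[O, q)`. -/
def cw (O p q : Plane) : ℝ := toIocMod Real.two_pi_pos 0 (Complex.arg ((p - O) / (q - O)))

/-- The counterclockwise angle, in `(0, 2π]`, from `[O, p)` to `[O, q)`. -/
def ccw (O p q : Plane) : ℝ := cw O q p

/-- `q` is the first point of `P`, other than `p`, that is met from `p` on, in the direction in
which `arc` measures angles. -/
def IsNext (arc : Plane → Plane → ℝ) (P : Finset Plane) (p q : Plane) : Prop :=
  q ∈ P ∧ q ≠ p ∧ ∀ x ∈ P, x ≠ p → arc p q ≤ arc p x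

/-- The first point of `P`, other than `p`, that is met from `p` on. -/
def next (arc : Plane → Plane → ℝ) (P : Finset Plane) (p : Plane) : Plane :=
  Classical.epsilon (IsNext arc P p)

/-- `P` consists of `n` distinct points of the nondegenerate circle `C`. -/
def OnCircle (n : ℕ) (P : Finset Plane) (C : Sphere Plane) : Prop :=
  P.card = n ∧ 0 < C.radius ∧ ∀ p ∈ P, p ∈ C

/-- `P` is a nondegenerate regular `n`-gon: `n` points on a circle such that the angle at the
centre between any point and its (clockwise) successor is `2π / n`. -/
def IsRegularNgon (n : ℕ) (P : Finset Plane) : Prop :=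
  ∃ C : Sphere Plane, OnCircle n P C ∧
    ∀ p ∈ P, ∀ q, IsNext (cw C.center) P p q → ∠ p C.center q = 2 * Real.pi / n

/-! ### Lyndon words and leader election -/

/-- A nonempty word that is lexicographically smaller than each of its nontrivial rotations. -/
def IsLyndon (w : List ℝ) : Prop :=
  w ≠ [] ∧ ∀ j, 0 < j → j < w.length → w < w.rotate j

/-- The string of angles of the robot at `r`: starting at `r`, all the robots are visited in the
direction of `arc`, and the angles at the centre `O` between consecutive ones are listed. -/
def stringOfAngles (arc : Plane → Plane → ℝ) (O : Plane) (P : Finset Plane) (r : Plane) :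
    List ℝ :=
  List.ofFn fun k : Fin P.card => ∠ ((next arc P)^[k] r) O ((next arc P)^[k + 1] r)

/-- The robots whose clockwise or counterclockwise string of angles is a Lyndon word. -/
def LWS (O : Plane) (P : Finset Plane) : Finset Plane :=
  P.filter fun r =>
    IsLyndon (stringOfAngles (cw O) O P r) ∨ IsLyndon (stringOfAngles (ccw O) O P r)

/-- The robots strictly between `a` and `b`, clockwise from `a` to `b`. -/
def side (O : Plane) (P : Finset Plane) (a b : Plane) : Finset Plane :=
  P.filter fun x => x ≠ a ∧ cw O a x < cw O a b

/-- `r` is the leader: the half-lines from `O` to the two members of `LWS` cut the circle into two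
sides, and `r` is the median robot of a side with an odd number of robots. -/
def IsLeader (O : Plane) (P : Finset Plane) (r : Plane) : Prop :=
  ∃ a b, a ≠ b ∧ LWS O P = {a, b} ∧ Odd (side O P a b).card ∧ r ∈ side O P a b ∧
    ((side O P a b).filter fun x => cw O a x < cw O a r).card = (side O P a b).card / 2

/-! ### Oriented configurations -/

/-- The intersection of the circle `C` with the half-line from its centre through `r`. -/
def radialPoint (C : Sphere Plane) (r : Plane) : Plane :=
  C.center + (C.radius / dist r C.center) • (r - C.center)

/-- `P` is an oriented configuration of `n` robots: all but the one at `r` are on `C`, that one is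
inside `C` and not at its centre, and no robot is on `C` in the direction of `r`. -/
def IsOriented (n : ℕ) (P : Finset Plane) (C : Sphere Plane) (r : Plane) : Prop :=
  P.card = n ∧ 0 < C.radius ∧ r ∈ P ∧ (∀ p ∈ P, p ≠ r → p ∈ C) ∧
    dist r C.center < C.radius ∧ r ≠ C.center ∧ radialPoint C r ∉ P

/-- The vertices of the regular `n`-gon inscribed in `C` that has `p₁` as a vertex. -/
def finalPos (n : ℕ) (C : Sphere Plane) (p₁ : Plane) : Finset Plane :=
  (Finset.range n).image fun k =>
    C.center + Complex.exp (2 * Real.pi * k / n * Complex.I) * (p₁ - C.center)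

/-- The procedure for an oriented configuration `P`, executed by the robot at `0`. The elected
robots are the first free robots in the two directions from `p₁`, and each of them goes to the
first free final position in the same direction. If they coincide, there is only one free robot
and only one free final position. -/
def phiO (n : ℕ) (P : Finset Plane) (C : Sphere Plane) (r : Plane) : Plane :=
  let O := C.center
  let p₁ := radialPoint C r
  let PS := finalPos n C p₁
  let FRS := P.filter fun x => x ≠ r ∧ x ∉ PS
  let freePos := PS.filter fun x => x ≠ p₁ ∧ x ∉ P
  if FRS = ∅ then
    if 0 = r then p₁ else 0
  else if 0 = next (cw O) FRS p₁ then next (cw O) freePos p₁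
  else if 0 = next (ccw O) FRS p₁ then next (ccw O) freePos p₁
  else 0

/-! ### The main algorithm -/

/-- The algorithm for the robot at `0`; `ψ` is the procedure that places the robots on a circle. -/
def phiNgon (n : ℕ) (ψ : Program) : Program := fun P =>
  if IsRegularNgon n P then 0
  else if h : ∃ C, ∃ r, IsOriented n P C r then phiO n P h.choose h.choose_spec.choose
  else if h : ∃ C, OnCircle n P C then
    if IsLeader h.choose.center P 0 then midpoint ℝ h.choose.center 0 else 0
  else ψ P

/-! ### Placing the robots on a circle -/

/-- The disc bounded by `C` contains all the points of `P`. -/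
def Encloses (C : Sphere Plane) (P : Finset Plane) : Prop :=
  0 ≤ C.radius ∧ ∀ p ∈ P, dist p C.center ≤ C.radius

/-- The smallest circle that encloses `P`. -/
def SEC (P : Finset Plane) : Sphere Plane :=
  Classical.epsilon fun C => Encloses C P ∧ ∀ C', Encloses C' P → C.radius ≤ C'.radius

/-- `y` is strictly closer to `0` than to all other points of `Q`: it belongs to the open Voronoi
cell of `0`. -/
def InCell (Q : Finset Plane) (y : Plane) : Prop := ∀ x ∈ Q, x ≠ 0 → dist y 0 < dist y x

/-- The points of `C` that the robot at `0` tries in turn: first the one in its own direction from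
the centre (in the direction of its first axis, if it stands at the centre), then this
point rotated by `1 / k` about the centre, for `k = 1, 2, …`. -/
def candidate (C : Sphere Plane) (k : ℕ) : Plane :=
  let start := if C.center = 0 then (C.radius : ℂ) else radialPoint C 0
  let θ : ℝ := if k = 0 then 0 else 1 / k
  C.center + Complex.exp (θ * Complex.I) * (start - C.center)

/-- A procedure that places the robots on a circle, for the robot at `0`. A robot on the smallest
enclosing circle stays. Another one goes to the first candidate that is unoccupied and lies in its
cell of the Voronoi diagram of the robots inside the circle, if there is one; otherwise it stays. -/
def phiCircle : Program := fun P =>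
  let C := SEC P
  let inside := P.filter fun x => dist x C.center < C.radius
  if 0 ∉ inside then 0
  else if h : ∃ k, candidate C k ∉ P ∧ InCell inside (candidate C k) then
    candidate C (Nat.find h)
  else 0

/-! ### The two tasks -/

/-- From distinct positions, under every fair scheduler and for all frames of the robots, the
program leads `n` robots to distinct positions on a nondegenerate circle. -/
def LeadsToCircle (n : ℕ) (A : Program) : Prop :=
  ∀ (F : Fin n → Frame) (sched : ℕ → Finset (Fin n)) (init : Fin n → Plane),
    IsFair sched → Function.Injective init →
      ∃ t, ∃ C, OnCircle n (occupied (run A F sched init t)) C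

/-- From distinct positions, under every fair scheduler and for all frames of the robots, the
program leads `n` robots in finite time to a nondegenerate regular `n`-gon, where they stay. -/
def SolvesCircleFormation (n : ℕ) (A : Program) : Prop :=
  ∀ (F : Fin n → Frame) (sched : ℕ → Finset (Fin n)) (init : Fin n → Plane),
    IsFair sched → Function.Injective init →
      ∃ T, IsRegularNgon n (occupied (run A F sched init T)) ∧
        ∀ t, T ≤ t → run A F sched init t = run A F sched init T

end CircleFormation

end

namespace CircleFormation

open EuclideanGeometry

/-! ### Directed arcs -/

/-! The configuration passes through three regimes: arbitrary, on a circle, oriented. Inside a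
regime an activation either changes nothing, or reaches the next regime, or lowers a natural number,
and some robot causes a change whenever it is active. Fairness then gives progress whatever subset
of robots is activated (`exists_run_of_measure`). A regular polygon is a fixed point.

Since the robots compute in private coordinates, every notion used by the program has to be
compatible with similarities, including those that reverse the orientation. A change of frame either
preserves `cw` or exchanges it with `ccw` (`cw_toLocal`), so statements about the cyclic order are
proved for an abstract `IsArc`, which is stable under reversal. As `n ≥ 5`, three common points
determine the circle, so the choices made by `phiNgon` do not depend on the robot.

Leader election is where primality enters. The strings of angles read in one direction are the
rotations of one word of prime length. If two of them agreed, the word would be constant and the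
polygon regular (`stringOfAngles_injOn`, `isRegularNgon_of_const`). Otherwise each direction has
exactly one Lyndon string. The two starting robots differ, because a Lyndon word has its first
letter strictly below its last one, and these letters are the two angles next to the starting robot
(`not_isLyndon_both`). The remaining `n - 2` robots are odd in number, so exactly one side is odd,
and its median is the same from both ends. When the leader moves to the middle of its radius, the
configuration becomes oriented.

In an oriented configuration there are as many free robots as free final positions. The two elected
robots coincide exactly when their targets do, so no collision occurs, and every move lowers the
number of free robots. When none is left, the inner robot fills the last vertex.

For `phiCircle`, the smallest enclosing circle depends only on the robots on it, which stay. The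
others land on it at unoccupied points of disjoint Voronoi cells, so the number of inner robots
drops. The inner robot farthest from the centre can always move (`inCell_candidate_start`,
`exists_candidate`).

For a general `ψ`, a run that never meets a circle, an oriented configuration or a regular polygon
is a run of `ψ` itself, which must reach a circle. -/

/-- `arc` measures directed arcs, in `(0, 2π]`, between the points of a circle `S`. -/
structure IsArc (S : Set Plane) (arc : Plane → Plane → ℝ) : Prop where
  pos : ∀ p ∈ S, ∀ q ∈ S, 0 < arc p q
  self : ∀ p ∈ S, arc p p = 2 * Real.pi
  swap : ∀ p ∈ S, ∀ q ∈ S, p ≠ q → arc p q + arc q p = 2 * Real.pi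
  add : ∀ p ∈ S, ∀ y ∈ S, ∀ q ∈ S, y ≠ q → arc p y ≤ arc p q → arc p y + arc y q = arc p q

theorem cw_pos (O p q : Plane) : 0 < cw O p q :=
  (toIocMod_mem_Ioc Real.two_pi_pos 0 _).1

theorem cw_le (O p q : Plane) : cw O p q ≤ 2 * Real.pi :=
  (toIocMod_mem_Ioc Real.two_pi_pos 0 _).2.trans_eq (zero_add _)

theorem cw_coe (O p q : Plane) : (cw O p q : Real.Angle) = Complex.arg ((p - O) / (q - O)) :=
  Real.Angle.coe_toIocMod _ _

theorem ccw_eq (O : Plane) : ccw O = fun p q => cw O q p := rfl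

theorem cw_inj {O p a b : Plane} {R : ℝ} (hR : 0 < R) (hp : p ≠ O) (ha : dist a O = R)
    (hb : dist b O = R) (h : cw O p a = cw O p b) : a = b := by
  have h1 : (cw O p a : Real.Angle) = cw O p b := by rw [h]
  rw [cw_coe, cw_coe, Complex.arg_coe_angle_eq_iff] at h1
  rw [dist_eq_norm] at ha hb
  have ha0 : a - O ≠ 0 := by rw [← norm_pos_iff, ha]; exact hR
  have hb0 : b - O ≠ 0 := by rw [← norm_pos_iff, hb]; exact hR
  have hp0 : p - O ≠ 0 := sub_ne_zero.mpr hp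
  have h2 : (p - O) / (a - O) = (p - O) / (b - O) :=
    Complex.ext_norm_arg (by rw [norm_div, norm_div, ha, hb]) h1
  rw [div_eq_div_iff ha0 hb0] at h2
  have h3 := mul_left_cancel₀ hp0 h2
  linear_combination -h3

theorem cw_self {O p : Plane} (hp : p ≠ O) : cw O p p = 2 * Real.pi := by
  have : (p - O) / (p - O) = 1 := div_self (sub_ne_zero.mpr hp)
  rw [cw, this, Complex.arg_one, toIocMod_apply_left, zero_add]

theorem cw_coe_add {O p y q : Plane} (hp : p ≠ O) (hy : y ≠ O) (hq : q ≠ O) :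
    ((cw O p y + cw O y q : ℝ) : Real.Angle) = cw O p q := by
  have hp0 : p - O ≠ 0 := sub_ne_zero.mpr hp
  have hy0 : y - O ≠ 0 := sub_ne_zero.mpr hy
  have hq0 : q - O ≠ 0 := sub_ne_zero.mpr hq
  rw [Real.Angle.coe_add, cw_coe, cw_coe, cw_coe, ← Complex.arg_mul_coe_angle
    (div_ne_zero hp0 hy0) (div_ne_zero hy0 hq0), div_mul_div_cancel₀ hy0]

/-- Arcs add up modulo `2π`, so the defect of each identity is `2πk`, and the bounds on the arcs
leave only `k = 0`. Because `cw O q q = 2π` and not `0`, additivity has to exclude `y = q`. -/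
theorem isArc_cw (O : Plane) {R : ℝ} (hR : 0 < R) : IsArc {x | dist x O = R} (cw O) := by
  have hne : ∀ x, dist x O = R → x ≠ O := by
    rintro x hx rfl
    rw [dist_self] at hx
    exact hR.ne hx
  have hlt : ∀ p q, dist p O = R → dist q O = R → p ≠ q → cw O p q < 2 * Real.pi := by
    intro p q hp hq hpq
    refine lt_of_le_of_ne (cw_le O p q) fun h => hpq ?_
    rw [← cw_self (hne p hp)] at h
    exact (cw_inj hR (hne p hp) hq hp h).symm
  have key : ∀ p y q, dist p O = R → dist y O = R → dist q O = R → ∃ k : ℤ,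
      cw O p y + cw O y q - cw O p q = 2 * Real.pi * k := by
    intro p y q hp hy hq
    exact Real.Angle.angle_eq_iff_two_pi_dvd_sub.mp (cw_coe_add (hne p hp) (hne y hy) (hne q hq))
  have hpi := Real.two_pi_pos
  refine ⟨fun p _ q _ => cw_pos O p q, fun p hp => cw_self (hne p hp), ?_, ?_⟩
  · intro p hp q hq hpq
    obtain ⟨k, hk⟩ := key p q p hp hq hp
    rw [cw_self (hne p hp)] at hk
    have h1 := cw_pos O p q
    have h2 := cw_pos O q p
    have h3 := hlt p q hp hq hpq
    have h4 := hlt q p hq hp hpq.symm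
    have h5 : (-1 : ℝ) < k := by nlinarith
    have h6 : (k : ℝ) < 1 := by nlinarith
    have : k = 0 := by
      have h5 : (-1 : ℤ) < k := by exact_mod_cast h5
      have h6 : k < (1 : ℤ) := by exact_mod_cast h6
      omega
    subst this
    simp at hk
    linarith
  · intro p hp y hy q hq hyq hle
    obtain ⟨k, hk⟩ := key p y q hp hy hq
    have h1 := cw_pos O p y
    have h2 := cw_pos O y q
    have h3 := hlt y q hy hq hyq
    have h4 := cw_le O p q
    have h5 : (-1 : ℝ) < k := by nlinarith
    have h6 : (k : ℝ) < 1 := by nlinarith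
    have : k = 0 := by
      have h5 : (-1 : ℤ) < k := by exact_mod_cast h5
      have h6 : k < (1 : ℤ) := by exact_mod_cast h6
      omega
    subst this
    simp at hk
    linarith

namespace IsArc

variable {S : Set Plane} {arc : Plane → Plane → ℝ}

theorem lt_two_pi (h : IsArc S arc) {p q : Plane} (hp : p ∈ S) (hq : q ∈ S) (hpq : p ≠ q) :
    arc p q < 2 * Real.pi := by
  linarith [h.swap p hp q hq hpq, h.pos q hq p hp]

theorem le_two_pi (h : IsArc S arc) {p q : Plane} (hp : p ∈ S) (hq : q ∈ S) :
    arc p q ≤ 2 * Real.pi := by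
  by_cases hpq : p = q
  · subst hpq
    exact (h.self p hp).le
  · exact (h.lt_two_pi hp hq hpq).le

theorem inj (h : IsArc S arc) {p a b : Plane} (hp : p ∈ S) (ha : a ∈ S) (hb : b ∈ S)
    (hab : arc p a = arc p b) : a = b := by
  by_contra hne
  linarith [h.add p hp a ha b hb hne hab.le, h.pos a ha b hb]

/-- The axioms are symmetric under reversal; this transfers each later statement from one direction
of travel to the other. -/
theorem flip (h : IsArc S arc) : IsArc S (fun p q => arc q p) := by
  refine ⟨fun p hp q hq => h.pos q hq p hp, h.self, fun p hp q hq hpq => h.swap q hq p hp hpq.symm,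
    ?_⟩
  intro p hp y hy q hq hyq hle
  by_cases hpq : p = q
  · subst hpq
    rw [h.self p hp]
    exact h.swap y hy p hp hyq
  by_cases hyp : y = p
  · subst hyp
    linarith [h.self y hy, h.lt_two_pi hq hy (Ne.symm hpq)]
  · have h1 := h.swap p hp y hy (Ne.symm hyp)
    have h2 := h.swap p hp q hq hpq
    have h3 := h.add p hp q hq y hy (Ne.symm hyq) (by linarith)
    linarith

end IsArc

/-! ### The cyclic order on a finite set of points of a circle -/

theorem exists_isNext (arc : Plane → Plane → ℝ) {P : Finset Plane} {p : Plane}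
    (hP : ∃ x ∈ P, x ≠ p) : ∃ q, IsNext arc P p q := by
  obtain ⟨x, hx, hxp⟩ := hP
  obtain ⟨q, hq, hmin⟩ := (P.erase p).exists_min_image (arc p)
    ⟨x, Finset.mem_erase.mpr ⟨hxp, hx⟩⟩
  rw [Finset.mem_erase] at hq
  exact ⟨q, hq.2, hq.1, fun y hy hyp => hmin y (Finset.mem_erase.mpr ⟨hyp, hy⟩)⟩

theorem next_spec (arc : Plane → Plane → ℝ) {P : Finset Plane} {p : Plane}
    (hP : ∃ x ∈ P, x ≠ p) : IsNext arc P p (next arc P p) :=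
  Classical.epsilon_spec (exists_isNext arc hP)

theorem IsNext.eq_next {arc : Plane → Plane → ℝ} {P : Finset Plane} {p q : Plane}
    (hinj : ∀ a ∈ P, ∀ b ∈ P, arc p a = arc p b → a = b) (h : IsNext arc P p q) :
    next arc P p = q := by
  have h' := next_spec arc ⟨q, h.1, h.2.1⟩
  exact hinj _ h'.1 _ h.1 (le_antisymm (h'.2.2 q h.1 h.2.1) (h.2.2 _ h'.1 h'.2.1))

namespace IsArc

variable {S : Set Plane} {arc : Plane → Plane → ℝ} {P : Finset Plane}

theorem isNext_next (_h : IsArc S arc) (hP : P.Nontrivial) (p : Plane) :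
    IsNext arc P p (next arc P p) := by
  apply next_spec
  exact hP.exists_ne p

theorem eq_next (h : IsArc S arc) (hS : ∀ x ∈ P, x ∈ S) {p q : Plane} (hp : p ∈ S)
    (hq : IsNext arc P p q) : next arc P p = q :=
  hq.eq_next fun a ha b hb hab => h.inj hp (hS a ha) (hS b hb) hab

/-- Any other point lies beyond the successor of `p`, hence is met after `p` on the way back: the
successor for the reversed arc is the predecessor. -/
theorem next_flip_next (h : IsArc S arc) (hS : ∀ x ∈ P, x ∈ S) (hP : P.Nontrivial) {p : Plane}
    (hp : p ∈ P) : next (fun p q => arc q p) P (next arc P p) = p := by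
  have hn := h.isNext_next hP p
  set y := next arc P p
  refine h.flip.eq_next hS (hS y hn.1) ⟨hp, hn.2.1.symm, fun x hx hxy => ?_⟩
  by_cases hxp : x = p
  · rw [hxp]
  · have h1 := h.add p (hS p hp) y (hS y hn.1) x (hS x hx) (Ne.symm hxy) (hn.2.2 x hx hxp)
    have h2 := h.swap x (hS x hx) y (hS y hn.1) hxy
    have h3 := h.le_two_pi (hS p hp) (hS x hx)
    change arc p y ≤ arc x y
    linarith

/-- If `x` were missed, take the point of `Q` with the smallest arc to `x`; its successor is in `Q`
and has a smaller one. Consequently `next` acts on `P` as a single cycle. -/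
theorem eq_of_next_closed (h : IsArc S arc) (hS : ∀ x ∈ P, x ∈ S) (hP : P.Nontrivial)
    {Q : Finset Plane} (hQP : Q ⊆ P) (hQ : Q.Nonempty) (hcl : ∀ q ∈ Q, next arc P q ∈ Q) :
    Q = P := by
  refine Finset.Subset.antisymm hQP fun x hx => ?_
  by_contra hxQ
  obtain ⟨q, hq, hmin⟩ := Q.exists_min_image (fun q => arc q x) hQ
  have hn := h.isNext_next hP q
  have hqx : x ≠ q := fun e => hxQ (e ▸ hq)
  have hyx : next arc P q ≠ x := fun e => hxQ (e ▸ hcl q hq)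
  have h1 := h.add q (hS q (hQP hq)) _ (hS _ hn.1) x (hS x hx) hyx (hn.2.2 x hx hqx)
  have h2 := hmin _ (hcl q hq)
  have h3 := h.pos q (hS q (hQP hq)) _ (hS _ hn.1)
  linarith

theorem next_iterate_mem (h : IsArc S arc) (hP : P.Nontrivial) {p : Plane}
    (hp : p ∈ P) (k : ℕ) : (next arc P)^[k] p ∈ P := by
  cases k with
  | zero => exact hp
  | succ k =>
    rw [Function.iterate_succ_apply']
    exact (h.isNext_next hP _).1

theorem mem_periodicPts (h : IsArc S arc) (hS : ∀ x ∈ P, x ∈ S) (hP : P.Nontrivial) {p : Plane}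
    (hp : p ∈ P) : p ∈ Function.periodicPts (next arc P) := by
  have := h.eq_of_next_closed hS hP (Q := P.filter fun x => ∃ k, (next arc P)^[k + 1] p = x)
    (Finset.filter_subset _ _)
    ⟨next arc P p, Finset.mem_filter.mpr ⟨(h.isNext_next hP p).1, 0, rfl⟩⟩ (by
      intro q hq
      obtain ⟨hq, k, rfl⟩ := Finset.mem_filter.mp hq
      refine Finset.mem_filter.mpr ⟨(h.isNext_next hP _).1, k + 1, ?_⟩
      rw [Function.iterate_succ_apply'])
  rw [← this] at hp
  obtain ⟨_, k, hk⟩ := Finset.mem_filter.mp hp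
  exact ⟨k + 1, Nat.succ_pos k, hk⟩

theorem image_iterate_minimalPeriod (h : IsArc S arc) (hS : ∀ x ∈ P, x ∈ S) (hP : P.Nontrivial)
    {p : Plane} (hp : p ∈ P) :
    (Finset.range (Function.minimalPeriod (next arc P) p)).image
      (fun k => (next arc P)^[k] p) = P := by
  have hpos := Function.minimalPeriod_pos_of_mem_periodicPts (h.mem_periodicPts hS hP hp)
  refine h.eq_of_next_closed hS hP ?_ ⟨p, ?_⟩ ?_
  · intro x hx
    obtain ⟨k, -, rfl⟩ := Finset.mem_image.mp hx
    exact h.next_iterate_mem hP hp k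
  · exact Finset.mem_image.mpr ⟨0, Finset.mem_range.mpr hpos, rfl⟩
  · intro q hq
    obtain ⟨k, -, rfl⟩ := Finset.mem_image.mp hq
    refine Finset.mem_image.mpr ⟨(k + 1) % Function.minimalPeriod (next arc P) p,
      Finset.mem_range.mpr (Nat.mod_lt _ hpos), ?_⟩
    rw [Function.iterate_mod_minimalPeriod_eq, Function.iterate_succ_apply']

theorem minimalPeriod_next (h : IsArc S arc) (hS : ∀ x ∈ P, x ∈ S) (hP : P.Nontrivial)
    {p : Plane} (hp : p ∈ P) : Function.minimalPeriod (next arc P) p = P.card := by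
  conv_rhs => rw [← h.image_iterate_minimalPeriod hS hP hp]
  rw [Finset.card_image_of_injOn, Finset.card_range]
  intro a ha b hb hab
  exact Function.iterate_injOn_Iio_minimalPeriod (by simpa using ha) (by simpa using hb) hab

theorem next_iterate_card (h : IsArc S arc) (hS : ∀ x ∈ P, x ∈ S) (hP : P.Nontrivial)
    {p : Plane} (hp : p ∈ P) : (next arc P)^[P.card] p = p := by
  rw [← h.minimalPeriod_next hS hP hp]
  exact Function.isPeriodicPt_minimalPeriod _ _

theorem exists_next_iterate (h : IsArc S arc) (hS : ∀ x ∈ P, x ∈ S) (hP : P.Nontrivial)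
    {p x : Plane} (hp : p ∈ P) (hx : x ∈ P) : ∃ k < P.card, (next arc P)^[k] p = x := by
  rw [← h.image_iterate_minimalPeriod hS hP hp, h.minimalPeriod_next hS hP hp] at hx
  simpa using hx

theorem next_iterate_ne (h : IsArc S arc) (hS : ∀ x ∈ P, x ∈ S) (hP : P.Nontrivial)
    {p : Plane} (hp : p ∈ P) {k : ℕ} (hk : 0 < k) (hkn : k < P.card) :
    (next arc P)^[k] p ≠ p := fun e => by
  have := Function.IsPeriodicPt.minimalPeriod_le hk e
  rw [h.minimalPeriod_next hS hP hp] at this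
  omega

/-- The sum telescopes up to one full turn. It has at least one term because the empty sum is `0`
while `arc p p = 2π`. -/
theorem sum_arc_next (h : IsArc S arc) (hS : ∀ x ∈ P, x ∈ S) (hP : P.Nontrivial)
    {p : Plane} (hp : p ∈ P) (k : ℕ) (hk : k + 1 ≤ P.card) :
    ∑ i ∈ Finset.range (k + 1), arc ((next arc P)^[i] p) ((next arc P)^[i + 1] p) =
      arc p ((next arc P)^[k + 1] p) := by
  induction k with
  | zero => simp
  | succ k ih =>
    rw [Finset.sum_range_succ, ih (by omega)]
    have hy := h.next_iterate_mem hP hp (k + 1)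
    have hyp := h.next_iterate_ne hS hP hp (Nat.succ_pos k) (by omega)
    rw [Function.iterate_succ_apply' _ (k + 1)]
    set y := (next arc P)^[k + 1] p
    have hn := h.isNext_next hP y
    set z := next arc P y
    have h1 := h.swap p (hS p hp) y (hS y hy) (Ne.symm hyp)
    -- When the walk closes up, the total is `arc p p = 2π`, and `swap` takes the place of `add`.
    by_cases hz : z = p
    · rw [hz, h.self p (hS p hp), h1]
    · have h2 := h.add y (hS y hy) z (hS z hn.1) p (hS p hp) hz (hn.2.2 p hp (Ne.symm hyp))
      have h3 := h.swap p (hS p hp) z (hS z hn.1) (Ne.symm hz)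
      linarith

theorem sum_arc_next_card (h : IsArc S arc) (hS : ∀ x ∈ P, x ∈ S) (hP : P.Nontrivial)
    {p : Plane} (hp : p ∈ P) :
    ∑ i ∈ Finset.range P.card, arc ((next arc P)^[i] p) ((next arc P)^[i + 1] p) =
      2 * Real.pi := by
  obtain ⟨k, hk⟩ : ∃ k, P.card = k + 1 := ⟨P.card - 1, by
    have := Finset.card_pos.mpr hP.nonempty
    omega⟩
  have := h.sum_arc_next hS hP hp k hk.ge
  rw [← hk, h.next_iterate_card hS hP hp, h.self p (hS p hp)] at this
  exact this

end IsArc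

/-! ### Unoriented angles and regular polygons -/

theorem angle_eq_cw {O p q : Plane} (hp : p ≠ O) (hq : q ≠ O) :
    ∠ p O q = min (cw O p q) (2 * Real.pi - cw O p q) := by
  have hp0 : p - O ≠ 0 := sub_ne_zero.mpr hp
  have hq0 : q - O ≠ 0 := sub_ne_zero.mpr hq
  have h1 : ∠ p O q = |((p - O) / (q - O)).arg| := Complex.angle_eq_abs_arg hp0 hq0
  rw [h1, cw]
  set θ := ((p - O) / (q - O)).arg with hθ
  have hpi := Real.pi_pos
  have hlo := Complex.neg_pi_lt_arg ((p - O) / (q - O))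
  have hhi := Complex.arg_le_pi ((p - O) / (q - O))
  rw [← hθ] at hlo hhi
  rcases lt_or_ge 0 θ with h | h
  · have : toIocMod Real.two_pi_pos 0 θ = θ :=
      (toIocMod_eq_iff _).mpr ⟨⟨h, by linarith⟩, 0, by simp⟩
    rw [this, abs_of_pos h, min_eq_left]
    linarith
  · have : toIocMod Real.two_pi_pos 0 θ = θ + 2 * Real.pi :=
      (toIocMod_eq_iff _).mpr ⟨⟨by linarith, by linarith⟩, -1, by simp⟩
    rw [this, abs_of_nonpos h, min_eq_right] <;> linarith

theorem OnCircle.dist_eq {n : ℕ} {P : Finset Plane} {C : Sphere Plane} (h : OnCircle n P C) :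
    ∀ x ∈ P, x ∈ {x | dist x C.center = C.radius} := fun x hx => h.2.2 x hx

theorem OnCircle.ne_center {n : ℕ} {P : Finset Plane} {C : Sphere Plane} (h : OnCircle n P C) :
    ∀ x ∈ P, x ≠ C.center := by
  rintro x hx rfl
  have := h.dist_eq _ hx
  rw [Set.mem_ofPred_eq, dist_self] at this
  exact h.2.1.ne this

theorem OnCircle.nontrivial {n : ℕ} {P : Finset Plane} {C : Sphere Plane} (h : OnCircle n P C)
    (hn : 2 ≤ n) : P.Nontrivial :=
  Finset.one_lt_card_iff_nontrivial.mp (by rw [h.1]; exact hn)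

/-- If the angles between neighbours are all the same, then the polygon is regular. -/
theorem isRegularNgon_of_const {n : ℕ} (hn : 3 ≤ n) {P : Finset Plane} {C : Sphere Plane}
    (h : OnCircle n P C) (α : ℝ) (hα : ∀ p ∈ P, ∠ p C.center (next (cw C.center) P p) = α) :
    IsRegularNgon n P := by
  have hA := isArc_cw C.center h.2.1
  have hS := h.dist_eq
  have hP := h.nontrivial (by omega)
  have hnc := h.ne_center
  obtain ⟨r, hr⟩ := hP.nonempty
  have hsum := hA.sum_arc_next_card hS hP hr
  have hmem := hA.next_iterate_mem hP hr
  set σ := next (cw C.center) P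
  set g : ℕ → ℝ := fun i => cw C.center (σ^[i] r) (σ^[i + 1] r)
  rw [h.1] at hsum
  have hg : ∀ i, min (g i) (2 * Real.pi - g i) = α := by
    intro i
    rw [← hα _ (hmem i), angle_eq_cw (hnc _ (hmem i)) (hnc _ (hA.isNext_next hP _).1)]
    simp only [g, Function.iterate_succ_apply', σ]
  have hgpos : ∀ i, 0 < g i := fun i => cw_pos _ _ _
  have hαpos : 0 < α := by
    rw [← hg 0]
    refine lt_min (hgpos 0) (sub_pos.mpr (hA.lt_two_pi (hS _ (hmem 0)) (hS _ (hmem 1)) ?_))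
    exact ((hA.isNext_next hP r).2.1).symm
  have hle : ∀ i, α ≤ g i := fun i => (hg i).symm.le.trans (min_le_left _ _)
  have hgα : ∀ i ∈ Finset.range n, g i = α := by
    intro i hi
    -- A gap with unoriented angle `α` is `α` or `2π - α`. One gap `2π - α` and at least two others,
    -- each at least `α`, would exceed the full turn.
    by_contra hne
    have h2 : g i = 2 * Real.pi - α := by
      rcases min_choice (g i) (2 * Real.pi - g i) with h' | h' <;> rw [hg i] at h'
      · exact absurd h'.symm hne
      · linarith
    have h3 := Finset.add_sum_erase _ g hi
    have h4 : ((Finset.range n).erase i).card • α ≤ ∑ j ∈ (Finset.range n).erase i, g j :=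
      Finset.card_nsmul_le_sum _ _ _ fun j _ => hle j
    rw [Finset.card_erase_of_mem hi, Finset.card_range, nsmul_eq_mul] at h4
    have h5 : (2 : ℝ) ≤ ((n - 1 : ℕ) : ℝ) := by
      have : 2 ≤ n - 1 := by omega
      exact_mod_cast this
    have h6 : 2 * α ≤ ((n - 1 : ℕ) : ℝ) * α := mul_le_mul_of_nonneg_right h5 hαpos.le
    have h7 : ∑ j ∈ Finset.range n, g j = 2 * Real.pi := hsum
    linarith
  have hval : α = 2 * Real.pi / n := by
    have h7 : ∑ j ∈ Finset.range n, g j = 2 * Real.pi := hsum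
    rw [Finset.sum_congr rfl hgα, Finset.sum_const, Finset.card_range, nsmul_eq_mul] at h7
    rw [eq_div_iff (by positivity), ← h7]
    ring
  refine ⟨C, h, fun p hp q hq => ?_⟩
  rw [← hval, ← hα p hp, ← hA.eq_next hS (hS p hp) hq]

/-- Makes the index a natural number; `Finset.bind_def` unfolds the coercion of the index set inside
`finalPos`. -/
theorem finalPos_eq (n : ℕ) (C : Sphere Plane) (p₁ : Plane) :
    finalPos n C p₁ = (Finset.range n).image fun k : ℕ =>
      C.center + Complex.exp (2 * Real.pi * k / n * Complex.I) * (p₁ - C.center) := by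
  ext x
  simp [finalPos, Finset.bind_def]

theorem mem_finalPos {n : ℕ} {C : Sphere Plane} {p₁ x : Plane} :
    x ∈ finalPos n C p₁ ↔ ∃ k < n,
      C.center + Complex.exp (2 * Real.pi * (k : ℕ) / n * Complex.I) * (p₁ - C.center) = x := by
  simp [finalPos_eq]

theorem mem_of_mem_finalPos {n : ℕ} {C : Sphere Plane} {p₁ x : Plane} (hp₁ : p₁ ∈ C)
    (hx : x ∈ finalPos n C p₁) : x ∈ C := by
  obtain ⟨k, -, rfl⟩ := mem_finalPos.mp hx
  have : (2 * Real.pi * k / n * Complex.I : ℂ) = ((2 * Real.pi * k / n : ℝ) : ℂ) * Complex.I := by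
    push_cast; ring
  rw [EuclideanGeometry.mem_sphere, dist_eq_norm, add_sub_cancel_left, norm_mul, this,
    Complex.norm_exp_ofReal_mul_I, one_mul, ← dist_eq_norm]
  exact hp₁

theorem isRegularNgon_finalPos {n : ℕ} (hn : 2 ≤ n) {C : Sphere Plane} (hC : 0 < C.radius)
    {p₁ : Plane} (hp₁ : p₁ ∈ C) (hcard : (finalPos n C p₁).card = n) :
    IsRegularNgon n (finalPos n C p₁) := by
  have hn0 : (0 : ℝ) < n := by positivity
  have hu : ‖p₁ - C.center‖ = C.radius := by rw [← dist_eq_norm]; exact hp₁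
  have hu0 : p₁ - C.center ≠ 0 := by rw [← norm_pos_iff, hu]; exact hC
  have hon : OnCircle n (finalPos n C p₁) C := ⟨hcard, hC, fun p hp => mem_of_mem_finalPos hp₁ hp⟩
  refine ⟨C, hon, fun p hp q hq => ?_⟩
  have hA := isArc_cw C.center hC
  have hS := hon.dist_eq
  have hnc := hon.ne_center
  obtain ⟨k, hk, rfl⟩ := mem_finalPos.mp hp
  set f : ℕ → Plane := fun k =>
    C.center + Complex.exp (2 * Real.pi * k / n * Complex.I) * (p₁ - C.center) with hf
  -- Going clockwise lowers the index, so the arc from vertex `j` to vertex `l` is governed by the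
  -- residue `m` of `j - l`, taken in `(0, n]`.
  have hcw : ∀ j l m : ℕ, 0 < m → m ≤ n → (∃ z : ℤ, (j : ℤ) = l + m + n * z) →
      cw C.center (f j) (f l) = 2 * Real.pi * m / n := by
    rintro j l m hm hmn ⟨z, hz⟩
    have h1 : (f j - C.center) / (f l - C.center) =
        Complex.exp ((2 * Real.pi * m / n : ℝ) * Complex.I) := by
      simp only [hf, add_sub_cancel_left]
      rw [mul_div_mul_right _ _ hu0, ← Complex.exp_sub, Complex.exp_eq_exp_iff_exists_int]
      refine ⟨z, ?_⟩
      have hz' : (j : ℂ) = l + m + n * z := by exact_mod_cast hz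
      have hn1 : (n : ℂ) ≠ 0 := by exact_mod_cast hn0.ne'
      push_cast
      rw [hz']
      field_simp
      ring
    have h2 : cw C.center (f j) (f l) = toIocMod Real.two_pi_pos 0 (2 * Real.pi * m / n) := by
      rw [cw, h1]
      rw [Complex.arg_exp_mul_I]
      simp only [toIocMod_toIocMod]
    rw [h2, toIocMod_eq_iff]
    refine ⟨⟨by positivity, ?_⟩, 0, by simp⟩
    rw [zero_add, div_le_iff₀ hn0]
    have : (m : ℝ) ≤ n := by exact_mod_cast hmn
    exact mul_le_mul_of_nonneg_left this Real.two_pi_pos.le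
  obtain ⟨l, hl, hlq⟩ := mem_finalPos.mp hq.1
  change f l = q at hlq
  have hqk : l ≠ k := by
    rintro rfl
    exact hq.2.1 hlq.symm
  obtain ⟨m, hm, hmn, hml⟩ : ∃ m : ℕ, 0 < m ∧ m < n ∧ ∃ z : ℤ, (k : ℤ) = l + m + n * z := by
    rcases lt_or_gt_of_ne hqk with h' | h'
    · exact ⟨k - l, by omega, by omega, 0, by push_cast [h'.le]; ring⟩
    · exact ⟨n + k - l, by omega, by omega, -1, by
        rw [Nat.cast_sub (by omega)]; push_cast; ring⟩
  -- `l'` is `k - 1` modulo `n`. The existence of this vertex forces the clockwise neighbour to have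
  -- `m = 1`.
  obtain ⟨l', hl', hml'⟩ : ∃ l' < n, ∃ z : ℤ, (k : ℤ) = l' + (1 : ℕ) + n * z := by
    rcases Nat.eq_zero_or_pos k with h' | h'
    · exact ⟨n - 1, by omega, -1, by push_cast [show 1 ≤ n by omega]; subst h'; push_cast; ring⟩
    · exact ⟨k - 1, by omega, 0, by push_cast [show 1 ≤ k from h']; ring⟩
  have e1 := hcw k l m hm hmn.le hml
  have e2 := hcw k l' 1 one_pos (by omega) hml'
  have hpi := Real.two_pi_pos
  have hlt : ((1 : ℕ) : ℝ) < n := by exact_mod_cast hn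
  have hl'P : f l' ∈ finalPos n C p₁ := mem_finalPos.mpr ⟨l', hl', rfl⟩
  have hne : f l' ≠ f k := by
    intro e
    rw [e, cw_self (hnc _ hp)] at e2
    rw [eq_div_iff hn0.ne'] at e2
    have := mul_left_cancel₀ hpi.ne' e2
    linarith
  have hmin := hq.2.2 _ hl'P hne
  change cw C.center (f k) q ≤ cw C.center (f k) (f l') at hmin
  rw [← hlq, e1, e2, div_le_div_iff_of_pos_right hn0] at hmin
  have hm1 : m = 1 := by
    have : (m : ℝ) ≤ (1 : ℕ) := le_of_mul_le_mul_left hmin hpi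
    have : m ≤ 1 := by exact_mod_cast this
    omega
  subst hm1
  change ∠ (f k) C.center q = _
  rw [angle_eq_cw (hnc _ hp) (hnc _ hq.1), ← hlq, e1, Nat.cast_one, mul_one, min_eq_left]
  have h2n : (2 : ℝ) ≤ n := by exact_mod_cast hn
  have : 2 * Real.pi / n ≤ 2 * Real.pi / 2 := div_le_div_of_nonneg_left hpi.le two_pos h2n
  linarith

theorem card_finalPos {n : ℕ} (hn : 0 < n) {C : Sphere Plane} (hC : 0 < C.radius)
    {p₁ : Plane} (hp₁ : p₁ ∈ C) : (finalPos n C p₁).card = n := by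
  have hu : ‖p₁ - C.center‖ = C.radius := by rw [← dist_eq_norm]; exact hp₁
  have hu0 : p₁ - C.center ≠ 0 := by rw [← norm_pos_iff, hu]; exact hC
  rw [finalPos_eq, Finset.card_image_of_injOn, Finset.card_range]
  intro a ha b hb hab
  simp only [Finset.coe_range, Set.mem_Iio] at ha hb
  simp only [add_right_inj, mul_eq_mul_right_iff, hu0, or_false] at hab
  have hprim := Complex.isPrimitiveRoot_exp n hn.ne'
  refine hprim.pow_inj ha hb ?_
  rw [← Complex.exp_nat_mul, ← Complex.exp_nat_mul]
  convert hab using 2 <;> ring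

/-! ### Lyndon words -/

/-- Since `a` is a lower bound, a strict inequality would need equal first letters; stripping them
repeats the situation until `[a] < [a]` remains. -/
theorem not_append_singleton_lt_cons {a : ℝ} :
    ∀ v : List ℝ, (∀ x ∈ v, a ≤ x) → ¬ v ++ [a] < a :: v
  | [], _ => by simp
  | b :: v, hv => by
    intro h
    rw [List.cons_append, List.cons_lt_cons_iff] at h
    rcases h with h | ⟨rfl, h⟩
    · exact absurd h (not_lt.mpr (hv b List.mem_cons_self))
    · exact not_append_singleton_lt_cons v (fun x hx => hv x (List.mem_cons_of_mem _ hx)) h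

theorem IsLyndon.head_le {a : ℝ} {v : List ℝ} (h : IsLyndon (a :: v)) : ∀ x ∈ v, a ≤ x := by
  intro x hx
  obtain ⟨j, hj, rfl⟩ := List.mem_iff_getElem.mp hx
  have := h.2 (j + 1) (Nat.succ_pos j) (by simpa using hj)
  rw [List.rotate_eq_drop_append_take (by simp; omega), List.drop_succ_cons,
    List.drop_eq_getElem_cons hj, List.cons_append, List.cons_lt_cons_iff] at this
  rcases this with h | h
  · exact h.le
  · exact h.1.le

/-- The head is minimal. If the last letter were equal to it, the rotation that brings this letter
to the front would not be larger than the word. -/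
theorem IsLyndon.head_lt_last {a c : ℝ} {v : List ℝ} (h : IsLyndon (a :: (v ++ [c]))) :
    a < c := by
  have hle := h.head_le
  refine lt_of_le_of_ne (hle c (by simp)) ?_
  rintro rfl
  have := h.2 (v.length + 1) (Nat.succ_pos _) (by simp)
  rw [List.rotate_eq_drop_append_take (by simp)] at this
  simp only [List.drop_succ_cons, List.drop_left, List.take_succ_cons, List.take_left,
    List.cons_append, List.nil_append, List.cons_lt_cons_iff, lt_irrefl, true_and,
    false_or] at this
  exact not_append_singleton_lt_cons v (fun x hx => hle x (by simp [hx])) this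

theorem IsLyndon.getElem_zero_lt {w : List ℝ} (h : IsLyndon w) {k : ℕ} (hk : w.length = k + 2) :
    w[0] < w[k + 1] := by
  match w, hk with
  | a :: u, hk =>
    have hu : u ≠ [] := by rintro rfl; simp at hk
    obtain ⟨v, c, rfl⟩ : ∃ v c, u = v ++ [c] :=
      ⟨u.dropLast, u.getLast hu, (List.dropLast_append_getLast hu).symm⟩
    have hv : v.length = k := by simpa using hk
    subst hv
    simpa using h.head_lt_last

/-- Both `j` and the length are periods of the word under `rotate 1`, hence so is their gcd, which
is `1`. -/
theorem rotate_one_of_prime {w : List ℝ} (hw : w.length.Prime) {j : ℕ} (hj : 0 < j)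
    (hjw : j < w.length) (h : w.rotate j = w) : w.rotate 1 = w := by
  have it : ∀ (k : ℕ) (l : List ℝ), (fun l : List ℝ => l.rotate 1)^[k] l = l.rotate k := by
    intro k
    induction k with
    | zero => simp
    | succ k ih => intro l; rw [Function.iterate_succ_apply, ih, List.rotate_rotate, add_comm]
  have h1 : Function.IsPeriodicPt (fun l : List ℝ => l.rotate 1) j w := (it j w).trans h
  have h2 : Function.IsPeriodicPt (fun l : List ℝ => l.rotate 1) w.length w :=
    (it _ w).trans (List.rotate_length w)
  have h3 := h1.gcd h2
  rwa [Nat.Coprime.gcd_eq_one (Nat.coprime_of_lt_prime hj.ne' hjw hw).symm] at h3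

/-! ### Strings of angles -/

@[simp]
theorem length_stringOfAngles (arc : Plane → Plane → ℝ) (O : Plane) (P : Finset Plane) (r : Plane) :
    (stringOfAngles arc O P r).length = P.card := by
  simp [stringOfAngles]

theorem getElem_stringOfAngles (arc : Plane → Plane → ℝ) (O : Plane) (P : Finset Plane) (r : Plane)
    (k : ℕ) (hk : k < (stringOfAngles arc O P r).length) :
    (stringOfAngles arc O P r)[k] = ∠ ((next arc P)^[k] r) O ((next arc P)^[k + 1] r) := by
  simp [stringOfAngles]

namespace IsArc

variable {S : Set Plane} {arc : Plane → Plane → ℝ} {P : Finset Plane}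

/-- Unoriented angles are symmetric: the angle from `p` to its predecessor is the angle from that
predecessor to its successor `p`. -/
theorem const_flip (h : IsArc S arc) (hS : ∀ x ∈ P, x ∈ S) (hP : P.Nontrivial) (O : Plane)
    (hc : ∃ α : ℝ, ∀ p ∈ P, ∠ p O (next arc P p) = α) :
    ∃ α : ℝ, ∀ p ∈ P, ∠ p O (next (fun p q => arc q p) P p) = α := by
  obtain ⟨α, hα⟩ := hc
  refine ⟨α, fun p hp => ?_⟩
  have := hα _ (h.flip.isNext_next hP p).1
  rw [angle_comm] at this
  have h2 := h.flip.next_flip_next hS hP hp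
  rwa [h2] at this

theorem rotate_stringOfAngles (h : IsArc S arc) (hS : ∀ x ∈ P, x ∈ S) (hP : P.Nontrivial)
    (O : Plane) {r : Plane} (hr : r ∈ P) (j : ℕ) :
    (stringOfAngles arc O P r).rotate j = stringOfAngles arc O P ((next arc P)^[j] r) := by
  refine List.ext_getElem (by simp) fun k h1 h2 => ?_
  have hper : Function.IsPeriodicPt (next arc P) P.card r := h.next_iterate_card hS hP hr
  rw [List.getElem_rotate, getElem_stringOfAngles, getElem_stringOfAngles, length_stringOfAngles,
    Function.iterate_succ_apply', hper.iterate_mod_apply, ← Function.iterate_add_apply,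
    ← Function.iterate_add_apply, ← Function.iterate_succ_apply' (next arc P)]
  congr 2
  omega

/-- Strings from two robots are rotations of each other. If they agree, a nontrivial rotation fixes
a word of prime length, so the word is constant, against `hnc`. -/
theorem stringOfAngles_injOn (h : IsArc S arc) (hS : ∀ x ∈ P, x ∈ S) (hP : P.card.Prime)
    (O : Plane) (hnc : ¬ ∃ α, ∀ p ∈ P, ∠ p O (next arc P p) = α) {r s : Plane} (hr : r ∈ P)
    (hs : s ∈ P) (hrs : r ≠ s) : stringOfAngles arc O P r ≠ stringOfAngles arc O P s := by
  intro heq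
  have hPn : P.Nontrivial := Finset.one_lt_card_iff_nontrivial.mp hP.one_lt
  obtain ⟨j, hj, rfl⟩ := h.exists_next_iterate hS hPn hr hs
  rw [← h.rotate_stringOfAngles hS hPn O hr] at heq
  have hj0 : 0 < j := by
    rcases Nat.eq_zero_or_pos j with rfl | h
    · exact absurd rfl hrs
    · exact h
  have h1 := rotate_one_of_prime (by simpa using hP) hj0 (by simpa using hj) heq.symm
  obtain ⟨α, hα⟩ := List.rotate_one_eq_self_iff_eq_replicate.mp h1
  refine hnc ⟨α, fun p hp => ?_⟩
  obtain ⟨k, hk, rfl⟩ := h.exists_next_iterate hS hPn hr hp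
  rw [← Function.iterate_succ_apply' (next arc P),
    ← getElem_stringOfAngles arc O P r k (by simpa using hk)]
  exact List.eq_of_mem_replicate (n := (stringOfAngles arc O P r).length)
    (by rw [← hα]; exact List.getElem_mem _)

theorem isLyndon_iff (h : IsArc S arc) (hS : ∀ x ∈ P, x ∈ S) (hP : P.Nontrivial)
    (O : Plane) {r : Plane} (hr : r ∈ P) : IsLyndon (stringOfAngles arc O P r) ↔
      ∀ s ∈ P, s ≠ r → stringOfAngles arc O P r < stringOfAngles arc O P s := by
  constructor
  · rintro ⟨-, hL⟩ s hs hsr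
    obtain ⟨j, hj, rfl⟩ := h.exists_next_iterate hS hP hr hs
    rw [← h.rotate_stringOfAngles hS hP O hr]
    refine hL j ?_ (by simpa using hj)
    rcases Nat.eq_zero_or_pos j with rfl | h
    · exact absurd rfl hsr
    · exact h
  · intro hmin
    refine ⟨?_, fun j hj hjn => ?_⟩
    · rw [← List.length_pos_iff, length_stringOfAngles]
      exact Finset.card_pos.mpr hP.nonempty
    · rw [length_stringOfAngles] at hjn
      rw [h.rotate_stringOfAngles hS hP O hr]
      exact hmin _ (h.next_iterate_mem hP hr j) (h.next_iterate_ne hS hP hr hj hjn)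

/-- The strings are pairwise distinct, so their lexicographic minimum is strict; being a strict
minimum is being Lyndon. -/
theorem exists_lyndon (h : IsArc S arc) (hS : ∀ x ∈ P, x ∈ S) (hP : P.card.Prime)
    (O : Plane) (hnc : ¬ ∃ α, ∀ p ∈ P, ∠ p O (next arc P p) = α) :
    ∃ r ∈ P, ∀ s ∈ P, IsLyndon (stringOfAngles arc O P s) ↔ s = r := by
  have hPn : P.Nontrivial := Finset.one_lt_card_iff_nontrivial.mp hP.one_lt
  obtain ⟨r, hr, hmin⟩ := P.exists_min_image (stringOfAngles arc O P) hPn.nonempty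
  have hlt : ∀ s ∈ P, s ≠ r → stringOfAngles arc O P r < stringOfAngles arc O P s :=
    fun s hs hsr => lt_of_le_of_ne (hmin s hs) (h.stringOfAngles_injOn hS hP O hnc hr hs hsr.symm)
  refine ⟨r, hr, fun s hs => ⟨fun hL => ?_, ?_⟩⟩
  · by_contra hsr
    exact lt_asymm (hlt s hs hsr)
      ((h.isLyndon_iff hS hPn O hs).mp hL r hr (Ne.symm hsr))
  · rintro rfl
    exact (h.isLyndon_iff hS hPn O hs).mpr hlt

/-- The two angles adjacent to `r` are the first and the last letter of its string. -/
theorem angle_lt_of_isLyndon (h : IsArc S arc) (hS : ∀ x ∈ P, x ∈ S) (hP : P.Nontrivial)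
    (O : Plane) {r : Plane} (hr : r ∈ P) (hL : IsLyndon (stringOfAngles arc O P r)) :
    ∠ r O (next arc P r) < ∠ (next (fun p q => arc q p) P r) O r := by
  obtain ⟨k, hk⟩ : ∃ k, P.card = k + 2 := ⟨P.card - 2, by
    have := Finset.one_lt_card_iff_nontrivial.mpr hP
    omega⟩
  have := hL.getElem_zero_lt (k := k) (by simpa using hk)
  have hlast : next (fun p q => arc q p) P r = (next arc P)^[k + 1] r := by
    have h1 := h.next_iterate_card hS hP hr
    rw [hk, Function.iterate_succ_apply'] at h1
    conv_lhs => rw [← h1]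
    exact h.next_flip_next hS hP (h.next_iterate_mem hP hr _)
  rw [getElem_stringOfAngles, getElem_stringOfAngles, show k + 1 + 1 = P.card by omega,
    h.next_iterate_card hS hP hr] at this
  rw [hlast]
  exact this

/-- Each direction would make the angle on its own side of `r` strictly the smaller of the two. -/
theorem not_isLyndon_both (h : IsArc S arc) (hS : ∀ x ∈ P, x ∈ S) (hP : P.Nontrivial)
    (O : Plane) {r : Plane} (hr : r ∈ P) (hL : IsLyndon (stringOfAngles arc O P r))
    (hL' : IsLyndon (stringOfAngles (fun p q => arc q p) O P r)) : False := by
  have h1 := h.angle_lt_of_isLyndon hS hP O hr hL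
  have h2 := h.flip.angle_lt_of_isLyndon hS hP O hr hL'
  rw [angle_comm _ _ r] at h1 h2
  exact lt_asymm h1 h2

end IsArc

theorem exists_LWS_eq_pair {n : ℕ} (hn : n.Prime) (hn5 : 5 ≤ n) {P : Finset Plane}
    {C : Sphere Plane} (h : OnCircle n P C) (hreg : ¬ IsRegularNgon n P) :
    ∃ a ∈ P, ∃ b ∈ P, a ≠ b ∧ LWS C.center P = {a, b} := by
  have hA := isArc_cw C.center h.2.1
  have hS := h.dist_eq
  have hPn := h.nontrivial (by omega)
  have hP : P.card.Prime := by rw [h.1]; exact hn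
  have hnc : ¬ ∃ α, ∀ p ∈ P, ∠ p C.center (next (cw C.center) P p) = α :=
    fun ⟨α, hα⟩ => hreg (isRegularNgon_of_const (by omega) h α hα)
  have hnc' : ¬ ∃ α, ∀ p ∈ P, ∠ p C.center (next (ccw C.center) P p) = α :=
    fun h' => hnc (hA.flip.const_flip hS hPn C.center h')
  obtain ⟨a, ha, hLa⟩ := hA.exists_lyndon hS hP C.center hnc
  obtain ⟨b, hb, hLb⟩ := hA.flip.exists_lyndon hS hP C.center hnc'
  refine ⟨a, ha, b, hb, ?_, ?_⟩
  · rintro rfl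
    exact hA.not_isLyndon_both hS hPn C.center ha ((hLa a ha).mpr rfl) ((hLb a ha).mpr rfl)
  · ext x
    rw [LWS, Finset.mem_filter, Finset.mem_insert, Finset.mem_singleton]
    constructor
    · rintro ⟨hx, h1 | h1⟩
      · exact Or.inl ((hLa x hx).mp h1)
      · exact Or.inr ((hLb x hx).mp h1)
    · rintro (rfl | rfl)
      · exact ⟨ha, Or.inl ((hLa x ha).mpr rfl)⟩
      · exact ⟨hb, Or.inr ((hLb x hb).mpr rfl)⟩

/-! ### The leader -/

/-- The robots strictly between `a` and `b`, in the direction of `arc` from `a` to `b`. -/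
noncomputable def sideBy (arc : Plane → Plane → ℝ) (P : Finset Plane) (a b : Plane) : Finset Plane :=
  P.filter fun x => x ≠ a ∧ arc a x < arc a b

/-- `r` is the median robot of a side, between the two members of `L`, with an odd number of
robots. -/
def IsLeaderBy (arc : Plane → Plane → ℝ) (L P : Finset Plane) (r : Plane) : Prop :=
  ∃ a b, a ≠ b ∧ L = {a, b} ∧ Odd (sideBy arc P a b).card ∧ r ∈ sideBy arc P a b ∧
    ((sideBy arc P a b).filter fun x => arc a x < arc a r).card = (sideBy arc P a b).card / 2

theorem isLeader_iff {O : Plane} {P : Finset Plane} {r : Plane} :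
    IsLeader O P r ↔ IsLeaderBy (cw O) (LWS O P) P r := Iff.rfl

theorem mem_sideBy {arc : Plane → Plane → ℝ} {P : Finset Plane} {a b x : Plane} :
    x ∈ sideBy arc P a b ↔ x ∈ P ∧ x ≠ a ∧ arc a x < arc a b := Finset.mem_filter

/-- A finite set on which `f` is injective has an element of each rank with respect to `f`. -/
theorem existsUnique_card_filter_lt_eq {α : Type*} {s : Finset α} {f : α → ℝ}
    (hf : Set.InjOn f s) {m : ℕ} (hm : m < s.card) :
    ∃! r, r ∈ s ∧ (s.filter fun x => f x < f r).card = m := by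
  have hlt : ∀ r ∈ s, ∀ r' ∈ s, f r < f r' →
      (s.filter fun x => f x < f r).card < (s.filter fun x => f x < f r').card := by
    intro r hr r' hr' h
    apply Finset.card_lt_card
    rw [Finset.ssubset_iff_of_subset (Finset.monotone_filter_right s fun x _ hx => hx.trans h)]
    exact ⟨r, Finset.mem_filter.mpr ⟨hr, h⟩, fun h' => lt_irrefl _ (Finset.mem_filter.mp h').2⟩
  have hinj : Set.InjOn (fun r => (s.filter fun x => f x < f r).card) s := by
    intro r hr r' hr' h
    by_contra hne
    rcases lt_or_gt_of_ne (fun e => hne (hf hr hr' e)) with h' | h'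
    · exact (hlt r hr r' hr' h').ne h
    · exact (hlt r' hr' r hr h').ne h.symm
  -- Ranks are injective with values in `range s.card`, a set of the same size as `s`; so every rank
  -- is attained.
  have hsurj := Finset.surjOn_of_injOn_of_card_le (t := Finset.range s.card)
    (fun r => (s.filter fun x => f x < f r).card) (by
      intro r hr
      rw [Finset.coe_range, Set.mem_Iio]
      refine Finset.card_lt_card (Finset.filter_ssubset.mpr ⟨r, hr, lt_irrefl _⟩)) hinj (by simp)
  obtain ⟨r, hr, hrm⟩ := hsurj (by simpa using hm : m ∈ (Finset.range s.card : Set ℕ))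
  exact ⟨r, ⟨hr, hrm⟩, fun r' hr' => hinj hr'.1 hr (hr'.2.trans hrm.symm)⟩

namespace IsArc

variable {S : Set Plane} {arc : Plane → Plane → ℝ} {P : Finset Plane}

theorem sideBy_flip (h : IsArc S arc) (hS : ∀ x ∈ P, x ∈ S) {a b : Plane} (ha : a ∈ P)
    (hb : b ∈ P) : sideBy (fun p q => arc q p) P b a = sideBy arc P a b := by
  ext x
  rw [mem_sideBy, mem_sideBy]
  refine and_congr_right fun hx => ⟨?_, ?_⟩
  · rintro ⟨hxb, hlt⟩
    refine ⟨fun e => lt_irrefl _ (e ▸ hlt), ?_⟩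
    by_contra hge
    have h1 := h.add a (hS a ha) b (hS b hb) x (hS x hx) (Ne.symm hxb) (not_lt.mp hge)
    have h2 := h.swap x (hS x hx) b (hS b hb) hxb
    have h3 := h.le_two_pi (hS a ha) (hS x hx)
    linarith
  · rintro ⟨hxa, hlt⟩
    have hxb : x ≠ b := fun e => lt_irrefl _ (e ▸ hlt)
    have h1 := h.add a (hS a ha) x (hS x hx) b (hS b hb) hxb hlt.le
    have h2 := h.pos a (hS a ha) x (hS x hx)
    exact ⟨hxb, by linarith⟩

theorem card_sideBy_add (h : IsArc S arc) (hS : ∀ x ∈ P, x ∈ S) {a b : Plane} (ha : a ∈ P)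
    (hb : b ∈ P) (hab : a ≠ b) :
    (sideBy arc P a b).card + (sideBy arc P b a).card + 2 = P.card := by
  have hdisj : Disjoint (sideBy arc P a b) (sideBy arc P b a) := by
    rw [Finset.disjoint_left]
    intro x h1 h2
    rw [← h.sideBy_flip hS ha hb] at h1
    rw [mem_sideBy] at h1 h2
    have h3 := h.swap a (hS a ha) b (hS b hb) hab
    have h4 := h.swap b (hS b hb) x (hS x h1.1) (Ne.symm h1.2.1)
    linarith [h1.2.2, h2.2.2]
  have hdisj2 : Disjoint (sideBy arc P a b ∪ sideBy arc P b a) {a, b} := by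
    rw [Finset.disjoint_right]
    intro x hx
    rw [Finset.mem_union, mem_sideBy, mem_sideBy]
    rw [Finset.mem_insert, Finset.mem_singleton] at hx
    rcases hx with rfl | rfl
    · rintro (h' | h')
      · exact h'.2.1 rfl
      · exact lt_irrefl _ h'.2.2
    · rintro (h' | h')
      · exact lt_irrefl _ h'.2.2
      · exact h'.2.1 rfl
  rw [← Finset.card_union_of_disjoint hdisj, ← Finset.card_pair hab,
    ← Finset.card_union_of_disjoint hdisj2]
  congr 1
  ext x
  rw [Finset.mem_union, Finset.mem_union, Finset.mem_insert, Finset.mem_singleton]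
  constructor
  · rintro ((h' | h') | rfl | rfl)
    · exact (mem_sideBy.mp h').1
    · exact (mem_sideBy.mp h').1
    · exact ha
    · exact hb
  · intro hx
    by_cases hxa : x = a
    · exact Or.inr (Or.inl hxa)
    by_cases hxb : x = b
    · exact Or.inr (Or.inr hxb)
    left
    rcases lt_or_ge (arc a x) (arc a b) with h' | h'
    · exact Or.inl (mem_sideBy.mpr ⟨hx, hxa, h'⟩)
    · right
      refine mem_sideBy.mpr ⟨hx, hxb, ?_⟩
      have h1 := h.add a (hS a ha) b (hS b hb) x (hS x hx) (Ne.symm hxb) h'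
      have h2 := h.lt_two_pi (hS a ha) (hS x hx) (Ne.symm hxa)
      have h3 := h.swap a (hS a ha) b (hS b hb) hab
      linarith

theorem sideBy_injOn (h : IsArc S arc) (hS : ∀ x ∈ P, x ∈ S) {a b : Plane} (ha : a ∈ P) :
    Set.InjOn (arc a) (sideBy arc P a b) := fun x hx y hy hxy =>
  h.inj (hS a ha) (hS x (mem_sideBy.mp hx).1) (hS y (mem_sideBy.mp hy).1) hxy

/-- The two sides contain `P.card - 2` robots together, an odd number, so exactly one of them is odd
and fixes the order of `a` and `b`. -/
theorem existsUnique_isLeaderBy (h : IsArc S arc) (hS : ∀ x ∈ P, x ∈ S) (hodd : Odd P.card)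
    {a b : Plane} (ha : a ∈ P) (hb : b ∈ P) (hab : a ≠ b) :
    ∃! r, IsLeaderBy arc {a, b} P r := by
  wlog ho : Odd (sideBy arc P a b).card generalizing a b with H
  · have hsum := h.card_sideBy_add hS ha hb hab
    rw [Finset.pair_comm]
    refine H hb ha hab.symm ?_
    rw [Nat.odd_iff] at *
    omega
  have hev : ¬ Odd (sideBy arc P b a).card := by
    have hsum := h.card_sideBy_add hS ha hb hab
    rw [Nat.odd_iff] at *
    omega
  obtain ⟨r, ⟨hr, hrm⟩, huniq⟩ := existsUnique_card_filter_lt_eq (h.sideBy_injOn hS (b := b) ha)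
    (m := (sideBy arc P a b).card / 2) (Nat.div_lt_self ho.pos one_lt_two)
  refine ⟨r, ⟨a, b, hab, rfl, ho, hr, hrm⟩, ?_⟩
  rintro r' ⟨a', b', hab', hpair, ho', hr', hrm'⟩
  have ha' : a' = a ∨ a' = b := by
    have : a' ∈ ({a, b} : Finset Plane) := by rw [hpair]; simp
    simpa using this
  have hb' : b' = a ∨ b' = b := by
    have : b' ∈ ({a, b} : Finset Plane) := by rw [hpair]; simp
    simpa using this
  rcases ha' with rfl | rfl
  · rcases hb' with rfl | rfl
    · exact absurd rfl hab'
    · exact huniq r' ⟨hr', hrm'⟩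
  · rcases hb' with rfl | rfl
    · exact absurd ho' hev
    · exact absurd rfl hab'

/-- In an odd side the middle element has the same rank from both ends. This is why robots of
opposite chirality elect the same leader. -/
theorem isLeaderBy_flip_of (h : IsArc S arc) (hS : ∀ x ∈ P, x ∈ S) {L : Finset Plane}
    (hL : L ⊆ P) {r : Plane} (hr : IsLeaderBy arc L P r) :
    IsLeaderBy (fun p q => arc q p) L P r := by
  obtain ⟨a, b, hab, rfl, ho, hr, hm⟩ := hr
  have ha : a ∈ P := hL (by simp)
  have hb : b ∈ P := hL (by simp)
  refine ⟨b, a, hab.symm, Finset.pair_comm a b, ?_⟩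
  rw [h.sideBy_flip hS ha hb]
  refine ⟨ho, hr, ?_⟩
  set T := sideBy arc P a b with hT
  have hinj := h.sideBy_injOn hS (b := b) ha
  have hsum : ∀ x ∈ T, arc a x + arc x b = arc a b := by
    intro x hx
    obtain ⟨hxP, -, hlt⟩ := mem_sideBy.mp hx
    exact h.add a (hS a ha) x (hS x hxP) b (hS b hb) (fun e => lt_irrefl _ (e ▸ hlt)) hlt.le
  have h1 : (T.filter fun x => arc x b < arc r b) =
      (T.filter fun x => ¬ arc a x < arc a r).erase r := by
    ext x
    rw [Finset.mem_erase, Finset.mem_filter, Finset.mem_filter, not_lt]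
    constructor
    · rintro ⟨hx, hlt⟩
      have := hsum x hx
      have := hsum r hr
      exact ⟨fun e => lt_irrefl _ (e ▸ hlt), hx, by linarith⟩
    · rintro ⟨hxr, hx, hle⟩
      have h2 := hsum x hx
      have h3 := hsum r hr
      have h4 : arc a r ≠ arc a x := fun e => hxr (hinj hx hr e.symm)
      have h5 := lt_of_le_of_ne hle h4
      exact ⟨hx, by linarith⟩
  have h2 := Finset.card_filter_add_card_filter_not (s := T) (fun x => arc a x < arc a r)
  rw [h1, Finset.card_erase_of_mem (Finset.mem_filter.mpr ⟨hr, lt_irrefl _⟩)]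
  rw [Nat.odd_iff] at ho
  omega

theorem isLeaderBy_flip (h : IsArc S arc) (hS : ∀ x ∈ P, x ∈ S) {L : Finset Plane}
    (hL : L ⊆ P) {r : Plane} :
    IsLeaderBy (fun p q => arc q p) L P r ↔ IsLeaderBy arc L P r :=
  ⟨h.flip.isLeaderBy_flip_of hS hL, h.isLeaderBy_flip_of hS hL⟩

end IsArc

theorem existsUnique_isLeader {n : ℕ} (hn : n.Prime) (hn5 : 5 ≤ n) {P : Finset Plane}
    {C : Sphere Plane} (h : OnCircle n P C) (hreg : ¬ IsRegularNgon n P) :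
    ∃! r, IsLeader C.center P r := by
  obtain ⟨a, ha, b, hb, hab, hL⟩ := exists_LWS_eq_pair hn hn5 h hreg
  simp only [isLeader_iff, hL]
  refine (isArc_cw C.center h.2.1).existsUnique_isLeaderBy h.dist_eq ?_ ha hb hab
  rw [h.1]
  exact hn.odd_of_ne_two (by omega)

theorem IsLeader.mem {O : Plane} {P : Finset Plane} {r : Plane} (h : IsLeader O P r) : r ∈ P := by
  obtain ⟨a, b, -, -, -, hr, -⟩ := h
  exact (Finset.mem_filter.mp hr).1

/-! ### Change of coordinates -/

section Local

variable (F : Frame) (p : Plane)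

theorem toLocal_sub (x y : Plane) :
    F.toLocal p x - F.toLocal p y = F.unit • F.axes (x - y) := by
  rw [Frame.toLocal, Frame.toLocal, ← smul_sub, ← map_sub, sub_sub_sub_cancel_right]

@[simp]
theorem toLocal_self : F.toLocal p p = 0 := by simp [Frame.toLocal]

theorem dist_toLocal (x y : Plane) :
    dist (F.toLocal p x) (F.toLocal p y) = F.unit * dist x y := by
  rw [dist_eq_norm, toLocal_sub, norm_smul, LinearIsometryEquiv.norm_map, ← dist_eq_norm,
    Real.norm_of_nonneg F.unit_pos.le]

@[simp]
theorem ofLocal_toLocal (x : Plane) : F.ofLocal p (F.toLocal p x) = x := by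
  rw [Frame.ofLocal, Frame.toLocal, inv_smul_smul₀ F.unit_pos.ne',
    LinearIsometryEquiv.symm_apply_apply, add_sub_cancel]

@[simp]
theorem toLocal_ofLocal (y : Plane) : F.toLocal p (F.ofLocal p y) = y := by
  rw [Frame.ofLocal, Frame.toLocal, add_sub_cancel_left, LinearIsometryEquiv.apply_symm_apply,
    smul_inv_smul₀ F.unit_pos.ne']

@[simp]
theorem ofLocal_zero : F.ofLocal p 0 = p := by simp [Frame.ofLocal]

theorem toLocal_injective : Function.Injective (F.toLocal p) :=
  Function.LeftInverse.injective (ofLocal_toLocal F p)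

@[simp]
theorem toLocal_inj {x y : Plane} : F.toLocal p x = F.toLocal p y ↔ x = y :=
  (toLocal_injective F p).eq_iff

@[simp]
theorem toLocal_mem_image {P : Finset Plane} {x : Plane} :
    F.toLocal p x ∈ P.image (F.toLocal p) ↔ x ∈ P :=
  (toLocal_injective F p).mem_finset_image

theorem card_image_toLocal (P : Finset Plane) : (P.image (F.toLocal p)).card = P.card :=
  Finset.card_image_of_injective _ (toLocal_injective F p)

@[simp]
theorem angle_toLocal (x y z : Plane) :
    ∠ (F.toLocal p x) (F.toLocal p y) (F.toLocal p z) = ∠ x y z := by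
  simp only [EuclideanGeometry.angle, vsub_eq_sub, toLocal_sub]
  rw [InnerProductGeometry.angle_smul_smul F.unit_pos.ne', ← LinearIsometryEquiv.coe_toLinearIsometry,
    LinearIsometry.angle_map]

theorem toLocal_eq_or : (∃ c : ℂ, c ≠ 0 ∧ ∀ x y, F.toLocal p x - F.toLocal p y = c * (x - y)) ∨
    ∃ c : ℂ, c ≠ 0 ∧ ∀ x y, F.toLocal p x - F.toLocal p y = c * (starRingEnd ℂ) (x - y) := by
  have hu : (F.unit : ℂ) ≠ 0 := by exact_mod_cast F.unit_pos.ne'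
  obtain ⟨a, h | h⟩ := linear_isometry_complex F.axes
  · left
    refine ⟨F.unit * a, mul_ne_zero hu a.coe_ne_zero, fun x y => ?_⟩
    rw [toLocal_sub, h, rotation_apply, Complex.real_smul, mul_assoc]
  · right
    refine ⟨F.unit * a, mul_ne_zero hu a.coe_ne_zero, fun x y => ?_⟩
    rw [toLocal_sub, h, LinearIsometryEquiv.trans_apply, rotation_apply, Complex.real_smul,
      mul_assoc, Complex.conjLIE_apply]

/-- A similarity of the plane multiplies differences by a constant, possibly after conjugation;
quotients of differences are thus kept or conjugated. -/
theorem cw_toLocal :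
    (∀ O a b, cw (F.toLocal p O) (F.toLocal p a) (F.toLocal p b) = cw O a b) ∨
      ∀ O a b, cw (F.toLocal p O) (F.toLocal p a) (F.toLocal p b) = ccw O a b := by
  rcases toLocal_eq_or F p with ⟨c, hc, h⟩ | ⟨c, hc, h⟩
  · left
    intro O a b
    rw [cw, h, h, mul_div_mul_left _ _ hc, cw]
  · right
    intro O a b
    -- `arg_conj` and `arg_inv` have the same exceptional value at `π`, so opposite points need no
    -- separate treatment.
    rw [cw, h, h, mul_div_mul_left _ _ hc, ccw, cw, ← map_div₀, ← inv_div (a - O) (b - O),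
      Complex.arg_conj, Complex.arg_inv]

/-- The circle `C` in local coordinates. -/
noncomputable def localSphere (C : Sphere Plane) : Sphere Plane :=
  ⟨F.toLocal p C.center, F.unit * C.radius⟩

theorem exists_localSphere_eq (C' : Sphere Plane) : ∃ C, localSphere F p C = C' := by
  refine ⟨⟨F.ofLocal p C'.center, F.unit⁻¹ * C'.radius⟩, ?_⟩
  rw [localSphere, toLocal_ofLocal, mul_inv_cancel_left₀ F.unit_pos.ne']

@[simp]
theorem toLocal_mem_localSphere {C : Sphere Plane} {x : Plane} :
    F.toLocal p x ∈ localSphere F p C ↔ x ∈ C := by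
  rw [EuclideanGeometry.mem_sphere, EuclideanGeometry.mem_sphere, localSphere, dist_toLocal,
    mul_right_inj' F.unit_pos.ne']

theorem localSphere_radius_pos {C : Sphere Plane} :
    0 < (localSphere F p C).radius ↔ 0 < C.radius :=
  mul_pos_iff_of_pos_left F.unit_pos

theorem onCircle_localSphere {n : ℕ} {P : Finset Plane} {C : Sphere Plane} :
    OnCircle n (P.image (F.toLocal p)) (localSphere F p C) ↔ OnCircle n P C := by
  rw [OnCircle, OnCircle, card_image_toLocal, localSphere_radius_pos, Finset.forall_mem_image]
  simp only [toLocal_mem_localSphere]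

theorem exists_onCircle_image {n : ℕ} {P : Finset Plane} :
    (∃ C, OnCircle n (P.image (F.toLocal p)) C) ↔ ∃ C, OnCircle n P C := by
  constructor
  · rintro ⟨C', h⟩
    obtain ⟨C, rfl⟩ := exists_localSphere_eq F p C'
    exact ⟨C, (onCircle_localSphere F p).mp h⟩
  · rintro ⟨C, h⟩
    exact ⟨_, (onCircle_localSphere F p).mpr h⟩

theorem radialPoint_localSphere (C : Sphere Plane) (r : Plane) :
    radialPoint (localSphere F p C) (F.toLocal p r) = F.toLocal p (radialPoint C r) := by
  rw [radialPoint, radialPoint, ← sub_eq_zero, localSphere]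
  simp only
  rw [dist_toLocal, mul_div_mul_left _ _ F.unit_pos.ne', toLocal_sub,
    add_sub_right_comm, toLocal_sub, sub_add_cancel_left, map_neg, map_smul, smul_comm, smul_neg,
    neg_add_cancel]

theorem isOriented_localSphere {n : ℕ} {P : Finset Plane} {C : Sphere Plane} {r : Plane} :
    IsOriented n (P.image (F.toLocal p)) (localSphere F p C) (F.toLocal p r) ↔
      IsOriented n P C r := by
  rw [IsOriented, IsOriented, card_image_toLocal, localSphere_radius_pos, toLocal_mem_image,
    Finset.forall_mem_image, radialPoint_localSphere, toLocal_mem_image]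
  simp only [toLocal_mem_localSphere, ne_eq, toLocal_inj]
  simp only [localSphere, dist_toLocal, toLocal_inj, mul_lt_mul_iff_right₀ F.unit_pos]

theorem exists_isOriented_image {n : ℕ} {P : Finset Plane} :
    (∃ C r, IsOriented n (P.image (F.toLocal p)) C r) ↔ ∃ C r, IsOriented n P C r := by
  constructor
  · rintro ⟨C', r', h⟩
    obtain ⟨C, rfl⟩ := exists_localSphere_eq F p C'
    obtain ⟨r, -, rfl⟩ := Finset.mem_image.mp h.2.2.1
    exact ⟨C, r, (isOriented_localSphere F p).mp h⟩
  · rintro ⟨C, r, h⟩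
    exact ⟨_, _, (isOriented_localSphere F p).mpr h⟩

/-- Describing the vertices by all `n`-th roots of unity removes the direction of enumeration, so
that reversing frames can be handled. -/
theorem mem_finalPos_iff {n : ℕ} (hn : 0 < n) {C : Sphere Plane} {p₁ x : Plane} :
    x ∈ finalPos n C p₁ ↔ ∃ w : ℂ, w ^ n = 1 ∧ C.center + w * (p₁ - C.center) = x := by
  have hprim := Complex.isPrimitiveRoot_exp n hn.ne'
  have hexp : ∀ k : ℕ, Complex.exp (2 * Real.pi * Complex.I / n) ^ k =
      Complex.exp (2 * Real.pi * k / n * Complex.I) := by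
    intro k
    rw [← Complex.exp_nat_mul]
    ring_nf
  rw [mem_finalPos]
  constructor
  · rintro ⟨k, -, rfl⟩
    refine ⟨_, ?_, rfl⟩
    rw [← hexp, ← pow_mul, mul_comm k, pow_mul, hprim.pow_eq_one, one_pow]
  · rintro ⟨w, hw, rfl⟩
    have : NeZero n := ⟨hn.ne'⟩
    obtain ⟨k, hk, rfl⟩ := hprim.eq_pow_of_pow_eq_one hw
    exact ⟨k, hk, by rw [hexp]⟩

theorem finalPos_localSphere {n : ℕ} (hn : 0 < n) (C : Sphere Plane) (p₁ : Plane) :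
    finalPos n (localSphere F p C) (F.toLocal p p₁) =
      (finalPos n C p₁).image (F.toLocal p) := by
  ext y
  obtain ⟨x, rfl⟩ : ∃ x, F.toLocal p x = y := ⟨_, toLocal_ofLocal F p y⟩
  rw [toLocal_mem_image, mem_finalPos_iff hn, mem_finalPos_iff hn]
  simp only [localSphere, ← eq_sub_iff_add_eq']
  rcases toLocal_eq_or F p with ⟨c, hc, h⟩ | ⟨c, hc, h⟩
  · simp only [h, mul_left_comm _ c, mul_right_inj' hc]
  · simp only [h, mul_left_comm _ c, mul_right_inj' hc]
    constructor
    · rintro ⟨w, hw, hx⟩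
      -- A reversing frame exchanges a root of unity with its conjugate.
      refine ⟨(starRingEnd ℂ) w, by rw [← map_pow, hw, map_one], ?_⟩
      apply (starRingEnd ℂ).injective
      rw [map_mul, Complex.conj_conj, hx]
    · rintro ⟨w, hw, hx⟩
      refine ⟨(starRingEnd ℂ) w, by rw [← map_pow, hw, map_one], ?_⟩
      rw [← map_mul, hx]

variable {S : Set Plane} {arc arc' : Plane → Plane → ℝ}

/-- The local `arc'` may be the clockwise arc while `arc` is the counterclockwise one; this covers
reversing frames. -/
theorem isNext_image {P : Finset Plane} {x y : Plane}
    (h : ∀ a b, arc' (F.toLocal p a) (F.toLocal p b) = arc a b) :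
    IsNext arc' (P.image (F.toLocal p)) (F.toLocal p x) (F.toLocal p y) ↔ IsNext arc P x y := by
  rw [IsNext, IsNext, toLocal_mem_image, Finset.forall_mem_image]
  simp only [ne_eq, toLocal_inj, h]

theorem IsArc.next_image (hA : IsArc S arc) {P : Finset Plane} (hS : ∀ x ∈ P, x ∈ S) {x : Plane}
    (hx : x ∈ S) (hP : ∃ y ∈ P, y ≠ x)
    (h : ∀ a b, arc' (F.toLocal p a) (F.toLocal p b) = arc a b) :
    next arc' (P.image (F.toLocal p)) (F.toLocal p x) = F.toLocal p (next arc P x) := by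
  apply IsNext.eq_next
  · rw [Finset.forall_mem_image]
    intro a ha
    rw [Finset.forall_mem_image]
    intro b hb hab
    rw [h, h] at hab
    rw [hA.inj hx (hS a ha) (hS b hb) hab]
  · exact (isNext_image F p h).mpr (next_spec arc hP)

theorem IsArc.next_iterate_image (hA : IsArc S arc) {P : Finset Plane} (hS : ∀ x ∈ P, x ∈ S)
    (hP : P.Nontrivial) {x : Plane} (hx : x ∈ P)
    (h : ∀ a b, arc' (F.toLocal p a) (F.toLocal p b) = arc a b) (k : ℕ) :
    (next arc' (P.image (F.toLocal p)))^[k] (F.toLocal p x) =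
      F.toLocal p ((next arc P)^[k] x) := by
  induction k with
  | zero => rfl
  | succ k ih =>
    rw [Function.iterate_succ_apply', ih, Function.iterate_succ_apply',
      hA.next_image F p hS (hS _ (hA.next_iterate_mem hP hx k)) (hP.exists_ne _) h]

theorem IsArc.stringOfAngles_image (hA : IsArc S arc) {P : Finset Plane} (hS : ∀ x ∈ P, x ∈ S)
    (hP : P.Nontrivial) {x : Plane} (hx : x ∈ P) (O : Plane)
    (h : ∀ a b, arc' (F.toLocal p a) (F.toLocal p b) = arc a b) :
    stringOfAngles arc' (F.toLocal p O) (P.image (F.toLocal p)) (F.toLocal p x) =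
      stringOfAngles arc O P x := by
  refine List.ext_getElem (by simp [card_image_toLocal]) fun k h1 h2 => ?_
  rw [getElem_stringOfAngles, getElem_stringOfAngles, hA.next_iterate_image F p hS hP hx h,
    hA.next_iterate_image F p hS hP hx h, angle_toLocal]

/-- A reversing frame exchanges the two words of each robot, and `LWS` does not distinguish them. -/
theorem LWS_image {n : ℕ} (hn : 2 ≤ n) {P : Finset Plane} {C : Sphere Plane}
    (hC : OnCircle n P C) :
    LWS (F.toLocal p C.center) (P.image (F.toLocal p)) = (LWS C.center P).image (F.toLocal p) := by
  have hA := isArc_cw C.center hC.2.1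
  have hP := hC.nontrivial hn
  ext y
  obtain ⟨x, rfl⟩ : ∃ x, F.toLocal p x = y := ⟨_, toLocal_ofLocal F p y⟩
  rw [toLocal_mem_image, LWS, LWS, Finset.mem_filter, Finset.mem_filter, toLocal_mem_image]
  refine and_congr_right fun hx => ?_
  rcases cw_toLocal F p with h | h
  · rw [hA.stringOfAngles_image F p hC.dist_eq hP hx C.center (h C.center),
      hA.flip.stringOfAngles_image F p hC.dist_eq hP hx C.center
        (arc' := ccw (F.toLocal p C.center)) fun a b => h C.center b a]
    rfl
  · rw [hA.flip.stringOfAngles_image F p hC.dist_eq hP hx C.center (h C.center),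
      hA.stringOfAngles_image F p hC.dist_eq hP hx C.center
        (arc' := ccw (F.toLocal p C.center)) fun a b => h C.center b a]
    exact or_comm

theorem isLeaderBy_image {L P : Finset Plane} {x : Plane}
    (h : ∀ a b, arc' (F.toLocal p a) (F.toLocal p b) = arc a b) :
    IsLeaderBy arc' (L.image (F.toLocal p)) (P.image (F.toLocal p)) (F.toLocal p x) ↔
      IsLeaderBy arc L P x := by
  have hside : ∀ a b, sideBy arc' (P.image (F.toLocal p)) (F.toLocal p a) (F.toLocal p b) =
      (sideBy arc P a b).image (F.toLocal p) := by
    intro a b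
    rw [sideBy, Finset.filter_image, sideBy]
    simp only [ne_eq, toLocal_inj, h]
  have hiff : ∀ a b, (F.toLocal p a ≠ F.toLocal p b ∧
      L.image (F.toLocal p) = {F.toLocal p a, F.toLocal p b} ∧
      Odd (sideBy arc' (P.image (F.toLocal p)) (F.toLocal p a) (F.toLocal p b)).card ∧
      F.toLocal p x ∈ sideBy arc' (P.image (F.toLocal p)) (F.toLocal p a) (F.toLocal p b) ∧
      ((sideBy arc' (P.image (F.toLocal p)) (F.toLocal p a) (F.toLocal p b)).filter
        fun y => arc' (F.toLocal p a) y < arc' (F.toLocal p a) (F.toLocal p x)).card =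
        (sideBy arc' (P.image (F.toLocal p)) (F.toLocal p a) (F.toLocal p b)).card / 2) ↔
      (a ≠ b ∧ L = {a, b} ∧ Odd (sideBy arc P a b).card ∧ x ∈ sideBy arc P a b ∧
        ((sideBy arc P a b).filter fun y => arc a y < arc a x).card =
          (sideBy arc P a b).card / 2) := by
    intro a b
    rw [hside, Finset.filter_image, card_image_toLocal, card_image_toLocal, toLocal_mem_image]
    simp only [ne_eq, toLocal_inj, h]
    rw [show ({F.toLocal p a, F.toLocal p b} : Finset Plane) = ({a, b} : Finset Plane).image
      (F.toLocal p) by simp, (Finset.image_injective (toLocal_injective F p)).eq_iff]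
  constructor
  · rintro ⟨a', b', h'⟩
    obtain ⟨a, rfl⟩ : ∃ a, F.toLocal p a = a' := ⟨_, toLocal_ofLocal F p a'⟩
    obtain ⟨b, rfl⟩ : ∃ b, F.toLocal p b = b' := ⟨_, toLocal_ofLocal F p b'⟩
    exact ⟨a, b, (hiff a b).mp h'⟩
  · rintro ⟨a, b, h'⟩
    exact ⟨_, _, (hiff a b).mpr h'⟩

theorem isLeader_image {n : ℕ} (hn : 2 ≤ n) {P : Finset Plane} {C : Sphere Plane}
    (hC : OnCircle n P C) {x : Plane} :
    IsLeader (F.toLocal p C.center) (P.image (F.toLocal p)) (F.toLocal p x) ↔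
      IsLeader C.center P x := by
  rw [isLeader_iff, isLeader_iff, LWS_image F p hn hC]
  rcases cw_toLocal F p with h | h
  · exact isLeaderBy_image F p (h C.center)
  · rw [isLeaderBy_image F p (h C.center)]
    exact (isArc_cw C.center hC.2.1).isLeaderBy_flip hC.dist_eq (Finset.filter_subset _ _)

end Local

/-- Asking only for a constant angle gives a condition on which `const_flip` acts directly, as
needed for reversing frames. -/
theorem isRegularNgon_iff {n : ℕ} (hn : 3 ≤ n) {P : Finset Plane} :
    IsRegularNgon n P ↔ ∃ C : Sphere Plane, OnCircle n P C ∧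
      ∃ α : ℝ, ∀ p ∈ P, ∠ p C.center (next (cw C.center) P p) = α := by
  constructor
  · rintro ⟨C, hC, h⟩
    exact ⟨C, hC, _, fun p hp => h p hp _
      ((isArc_cw C.center hC.2.1).isNext_next (hC.nontrivial (by omega)) p)⟩
  · rintro ⟨C, hC, α, hα⟩
    exact isRegularNgon_of_const hn hC α hα

theorem isRegularNgon_image {n : ℕ} (hn : 3 ≤ n) (F : Frame) (p : Plane) {P : Finset Plane} :
    IsRegularNgon n (P.image (F.toLocal p)) ↔ IsRegularNgon n P := by
  have key : ∀ C, OnCircle n P C →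
      ((∃ α : ℝ, ∀ y ∈ P.image (F.toLocal p), ∠ y (F.toLocal p C.center)
        (next (cw (F.toLocal p C.center)) (P.image (F.toLocal p)) y) = α) ↔
      ∃ α : ℝ, ∀ p ∈ P, ∠ p C.center (next (cw C.center) P p) = α) := by
    intro C hC
    have hA := isArc_cw C.center hC.2.1
    have hP := hC.nontrivial (show 2 ≤ n by omega)
    simp only [Finset.forall_mem_image]
    rcases cw_toLocal F p with h | h
    · refine exists_congr fun α => forall₂_congr fun x hx => ?_
      rw [hA.next_image F p hC.dist_eq (hC.dist_eq x hx) (hP.exists_ne _) (h C.center),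
        angle_toLocal]
    · refine Iff.trans (b := ∃ α : ℝ, ∀ p ∈ P, ∠ p C.center (next (ccw C.center) P p) = α)
        (exists_congr fun α => forall₂_congr fun x hx => ?_)
        ⟨hA.flip.const_flip hC.dist_eq hP C.center, hA.const_flip hC.dist_eq hP C.center⟩
      rw [hA.flip.next_image F p hC.dist_eq (hC.dist_eq x hx) (hP.exists_ne _) (h C.center),
        angle_toLocal]
      rfl
  rw [isRegularNgon_iff hn, isRegularNgon_iff hn]
  constructor
  · rintro ⟨C', hC', h⟩
    obtain ⟨C, rfl⟩ := exists_localSphere_eq F p C'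
    rw [onCircle_localSphere] at hC'
    exact ⟨C, hC', (key C hC').mp h⟩
  · rintro ⟨C, hC, h⟩
    exact ⟨_, (onCircle_localSphere F p).mpr hC, (key C hC).mpr h⟩

/-! ### Uniqueness of the circle -/

theorem sphere_eq_of_three {Q : Finset Plane} (hQ : 3 ≤ Q.card) {C C' : Sphere Plane}
    (h : ∀ x ∈ Q, x ∈ C) (h' : ∀ x ∈ Q, x ∈ C') : C = C' := by
  obtain ⟨a, ha, b, hb, c, hc, hab, hac, hbc⟩ := Finset.two_lt_card.mp hQ
  by_contra hne
  rcases eq_of_mem_sphere_of_mem_sphere_of_finrank_eq_two Complex.finrank_real_complex hne hab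
    (h a ha) (h b hb) (h c hc) (h' a ha) (h' b hb) (h' c hc) with e | e
  · exact hac e.symm
  · exact hbc e.symm

theorem OnCircle.unique {n : ℕ} (hn : 3 ≤ n) {P : Finset Plane} {C C' : Sphere Plane}
    (h : OnCircle n P C) (h' : OnCircle n P C') : C = C' :=
  sphere_eq_of_three (by rw [h.1]; exact hn) h.2.2 h'.2.2

/-! ### Oriented configurations -/

/-- The robots, other than the one at `r`, that are not at a final position. -/
noncomputable def freeRobots (n : ℕ) (P : Finset Plane) (C : Sphere Plane) (r : Plane) :
    Finset Plane :=
  P.filter fun x => x ≠ r ∧ x ∉ finalPos n C (radialPoint C r)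

/-- The final positions, other than the one in the direction of `r`, that are not occupied. -/
noncomputable def freePositions (n : ℕ) (P : Finset Plane) (C : Sphere Plane) (r : Plane) :
    Finset Plane :=
  (finalPos n C (radialPoint C r)).filter fun x => x ≠ radialPoint C r ∧ x ∉ P

theorem mem_freeRobots {n : ℕ} {P : Finset Plane} {C : Sphere Plane} {r x : Plane} :
    x ∈ freeRobots n P C r ↔ x ∈ P ∧ x ≠ r ∧ x ∉ finalPos n C (radialPoint C r) :=
  Finset.mem_filter

theorem mem_freePositions {n : ℕ} {P : Finset Plane} {C : Sphere Plane} {r x : Plane} :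
    x ∈ freePositions n P C r ↔
      x ∈ finalPos n C (radialPoint C r) ∧ x ≠ radialPoint C r ∧ x ∉ P :=
  Finset.mem_filter

theorem self_mem_finalPos {n : ℕ} (hn : 0 < n) (C : Sphere Plane) (p₁ : Plane) :
    p₁ ∈ finalPos n C p₁ :=
  (mem_finalPos_iff hn).mpr ⟨1, one_pow n, by ring⟩

namespace IsOriented

variable {n : ℕ} {P : Finset Plane} {C : Sphere Plane} {r : Plane}

theorem notMem (h : IsOriented n P C r) : r ∉ C := fun h' => h.2.2.2.2.1.ne h'

theorem radialPoint_mem (h : IsOriented n P C r) : radialPoint C r ∈ C := by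
  have hd : 0 < dist r C.center := dist_pos.mpr h.2.2.2.2.2.1
  rw [EuclideanGeometry.mem_sphere, radialPoint, dist_eq_norm, add_sub_cancel_left, norm_smul,
    ← dist_eq_norm, Real.norm_of_nonneg (div_pos h.2.1 hd).le, div_mul_cancel₀ _ hd.ne']

/-- Discarding `r` and `r'` leaves at least three of the `n ≥ 5` points, which lie on both circles.
-/
theorem sphere_eq (h : IsOriented n P C r) (hn : 5 ≤ n) {C' : Sphere Plane} {r' : Plane}
    (hC' : ∀ x ∈ P, x ≠ r' → x ∈ C') : C = C' := by
  refine sphere_eq_of_three (Q := (P.erase r).erase r') ?_ ?_ ?_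
  · have h1 := Finset.pred_card_le_card_erase (s := P) (a := r)
    have h2 := Finset.pred_card_le_card_erase (s := P.erase r) (a := r')
    have h3 := h.1
    omega
  · intro x hx
    rw [Finset.mem_erase, Finset.mem_erase] at hx
    exact h.2.2.2.1 x hx.2.2 hx.2.1
  · intro x hx
    rw [Finset.mem_erase, Finset.mem_erase] at hx
    exact hC' x hx.2.2 hx.1

theorem unique (h : IsOriented n P C r) (hn : 5 ≤ n) {C' : Sphere Plane} {r' : Plane}
    (h' : IsOriented n P C' r') : C = C' ∧ r = r' := by
  have hC := h.sphere_eq hn h'.2.2.2.1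
  refine ⟨hC, ?_⟩
  by_contra hne
  exact h.notMem (hC ▸ h'.2.2.2.1 r h.2.2.1 hne)

theorem not_onCircle (h : IsOriented n P C r) (hn : 5 ≤ n) {C' : Sphere Plane} :
    ¬ OnCircle n P C' := fun h' => by
  have hC := h.sphere_eq hn (r' := r) fun x hx _ => h'.2.2 x hx
  exact h.notMem (hC ▸ h'.2.2 r h.2.2.1)

theorem not_isRegularNgon (h : IsOriented n P C r) (hn : 5 ≤ n) : ¬ IsRegularNgon n P :=
  fun ⟨_, h', _⟩ => h.not_onCircle hn h'

/-- There are `n - 1` robots besides `r` and `n - 1` vertices besides `p₁`; the occupied vertices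
are counted once in each family and cancel. -/
theorem card_freePositions (h : IsOriented n P C r) (hn : 5 ≤ n) :
    (freePositions n P C r).card = (freeRobots n P C r).card := by
  have hn0 : 0 < n := by omega
  have h1 := Finset.card_filter_add_card_filter_not (s := P.erase r)
    (fun x => x ∈ finalPos n C (radialPoint C r))
  have h2 := Finset.card_filter_add_card_filter_not
    (s := (finalPos n C (radialPoint C r)).erase (radialPoint C r)) (fun x => x ∈ P)
  rw [Finset.card_erase_of_mem h.2.2.1, h.1] at h1
  rw [Finset.card_erase_of_mem (self_mem_finalPos hn0 _ _),
    card_finalPos hn0 h.2.1 h.radialPoint_mem] at h2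
  have h3 : (P.erase r).filter (fun x => x ∈ finalPos n C (radialPoint C r)) =
      ((finalPos n C (radialPoint C r)).erase (radialPoint C r)).filter (fun x => x ∈ P) := by
    ext x
    simp only [Finset.mem_filter, Finset.mem_erase]
    constructor
    · rintro ⟨⟨-, hxP⟩, hx⟩
      exact ⟨⟨fun e => h.2.2.2.2.2.2 (e ▸ hxP), hx⟩, hxP⟩
    · rintro ⟨⟨-, hx⟩, hxP⟩
      exact ⟨⟨fun e => h.notMem (e ▸ mem_of_mem_finalPos h.radialPoint_mem hx), hxP⟩, hx⟩
  have h4 : (P.erase r).filter (fun x => x ∉ finalPos n C (radialPoint C r)) =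
      freeRobots n P C r := by
    ext x
    simp only [Finset.mem_filter, Finset.mem_erase, mem_freeRobots]
    tauto
  have h5 : ((finalPos n C (radialPoint C r)).erase (radialPoint C r)).filter (fun x => x ∉ P) =
      freePositions n P C r := by
    ext x
    simp only [Finset.mem_filter, Finset.mem_erase, mem_freePositions]
    tauto
  rw [h3, h4] at h1
  rw [h5] at h2
  omega

theorem isArc (h : IsOriented n P C r) : IsArc {x | dist x C.center = C.radius} (cw C.center) :=
  isArc_cw C.center h.2.1

theorem freeRobots_subset (h : IsOriented n P C r) :
    ∀ x ∈ freeRobots n P C r, x ∈ {x | dist x C.center = C.radius} := fun x hx =>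
  h.2.2.2.1 x (mem_freeRobots.mp hx).1 (mem_freeRobots.mp hx).2.1

theorem freePositions_subset (h : IsOriented n P C r) :
    ∀ x ∈ freePositions n P C r, x ∈ {x | dist x C.center = C.radius} := fun _ hx =>
  mem_of_mem_finalPos h.radialPoint_mem (mem_freePositions.mp hx).1

theorem ne_of_mem_freeRobots (h : IsOriented n P C r) :
    ∀ x ∈ freeRobots n P C r, x ≠ radialPoint C r := fun _ hx e =>
  h.2.2.2.2.2.2 (e ▸ (mem_freeRobots.mp hx).1)

theorem ne_of_mem_freePositions :
    ∀ x ∈ freePositions n P C r, x ≠ radialPoint C r := fun _ hx =>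
  (mem_freePositions.mp hx).2.1

theorem freePositions_nonempty (h : IsOriented n P C r) (hn : 5 ≤ n)
    (hF : (freeRobots n P C r).Nonempty) : (freePositions n P C r).Nonempty := by
  rw [← Finset.card_pos, h.card_freePositions hn]
  exact Finset.card_pos.mpr hF

end IsOriented

theorem next_mem (arc : Plane → Plane → ℝ) {Q : Finset Plane} {p : Plane}
    (hp : ∀ x ∈ Q, x ≠ p) (hQ : Q.Nonempty) : next arc Q p ∈ Q := by
  obtain ⟨x, hx⟩ := hQ
  exact (next_spec arc ⟨x, hx, hp x hx⟩).1

/-- If the first points in the two directions coincide, then there is only one point. -/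
theorem IsArc.card_eq_one_of_next_eq {S : Set Plane} {arc : Plane → Plane → ℝ} (h : IsArc S arc)
    {Q : Finset Plane} (hS : ∀ x ∈ Q, x ∈ S) {p : Plane} (hpS : p ∈ S)
    (hp : ∀ x ∈ Q, x ≠ p) (hQ : Q.Nonempty)
    (he : next arc Q p = next (fun p q => arc q p) Q p) : Q.card = 1 := by
  obtain ⟨y, hy⟩ := hQ
  have h1 := next_spec arc ⟨y, hy, hp y hy⟩
  have h2 := next_spec (fun p q => arc q p) ⟨y, hy, hp y hy⟩
  rw [← he] at h2
  set q := next arc Q p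
  refine Finset.card_eq_one.mpr ⟨q, Finset.eq_singleton_iff_unique_mem.mpr ⟨h1.1, fun x hx => ?_⟩⟩
  have h3 := h1.2.2 x hx (hp x hx)
  have h4 : arc q p ≤ arc x p := h2.2.2 x hx (hp x hx)
  have h5 := h.swap p hpS q (hS q h1.1) (Ne.symm h1.2.1)
  have h6 := h.swap p hpS x (hS x hx) (Ne.symm (hp x hx))
  exact h.inj hpS (hS x hx) (hS q h1.1) (by linarith)

theorem next_eq_next_of_card_eq_one (arc arc' : Plane → Plane → ℝ) {Q : Finset Plane} {p : Plane}
    (hp : ∀ x ∈ Q, x ≠ p) (hQ : Q.card = 1) : next arc Q p = next arc' Q p := by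
  obtain ⟨y, rfl⟩ := Finset.card_eq_one.mp hQ
  have h1 := next_mem arc hp (Finset.singleton_nonempty y)
  have h2 := next_mem arc' hp (Finset.singleton_nonempty y)
  rw [Finset.mem_singleton] at h1 h2
  rw [h1, h2]

/-- If the elected robots coincide, then so do their destinations. -/
theorem IsOriented.next_freePositions_eq_iff {n : ℕ} {P : Finset Plane} {C : Sphere Plane}
    {r : Plane} (h : IsOriented n P C r) (hn : 5 ≤ n) (hF : (freeRobots n P C r).Nonempty) :
    next (cw C.center) (freePositions n P C r) (radialPoint C r) =
      next (ccw C.center) (freePositions n P C r) (radialPoint C r) ↔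
    next (cw C.center) (freeRobots n P C r) (radialPoint C r) =
      next (ccw C.center) (freeRobots n P C r) (radialPoint C r) := by
  have hcard := h.card_freePositions hn
  -- A coincidence on either side means that the set has one element, and the two sets have the same
  -- size.
  constructor
  · intro he
    refine next_eq_next_of_card_eq_one _ _ h.ne_of_mem_freeRobots ?_
    rw [← hcard]
    exact h.isArc.card_eq_one_of_next_eq h.freePositions_subset h.radialPoint_mem
      ne_of_mem_freePositions (h.freePositions_nonempty hn hF) he
  · intro he
    refine next_eq_next_of_card_eq_one _ _ ne_of_mem_freePositions ?_
    rw [hcard]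
    exact h.isArc.card_eq_one_of_next_eq h.freeRobots_subset h.radialPoint_mem
      h.ne_of_mem_freeRobots hF he

/-- The destination of the robot at `x` in an oriented configuration. -/
noncomputable def orientedMove (n : ℕ) (P : Finset Plane) (C : Sphere Plane) (r x : Plane) :
    Plane :=
  if freeRobots n P C r = ∅ then
    if x = r then radialPoint C r else x
  else if x = next (cw C.center) (freeRobots n P C r) (radialPoint C r) then
    next (cw C.center) (freePositions n P C r) (radialPoint C r)
  else if x = next (ccw C.center) (freeRobots n P C r) (radialPoint C r) then
    next (ccw C.center) (freePositions n P C r) (radialPoint C r)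
  else x

theorem phiO_eq {n : ℕ} {P : Finset Plane} {C : Sphere Plane} {r : Plane} :
    phiO n P C r = orientedMove n P C r 0 := rfl

theorem freeRobots_image {n : ℕ} (hn : 0 < n) (F : Frame) (p : Plane) {P : Finset Plane}
    {C : Sphere Plane} {r : Plane} :
    freeRobots n (P.image (F.toLocal p)) (localSphere F p C) (F.toLocal p r) =
      (freeRobots n P C r).image (F.toLocal p) := by
  rw [freeRobots, freeRobots, radialPoint_localSphere, finalPos_localSphere F p hn,
    Finset.filter_image]
  simp only [ne_eq, toLocal_inj, toLocal_mem_image]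

theorem freePositions_image {n : ℕ} (hn : 0 < n) (F : Frame) (p : Plane) {P : Finset Plane}
    {C : Sphere Plane} {r : Plane} :
    freePositions n (P.image (F.toLocal p)) (localSphere F p C) (F.toLocal p r) =
      (freePositions n P C r).image (F.toLocal p) := by
  rw [freePositions, freePositions, radialPoint_localSphere, finalPos_localSphere F p hn,
    Finset.filter_image]
  simp only [ne_eq, toLocal_inj, toLocal_mem_image]

theorem orientedMove_image {n : ℕ} (hn : 5 ≤ n) (F : Frame) (p : Plane) {P : Finset Plane}
    {C : Sphere Plane} {r x : Plane} (h : IsOriented n P C r) :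
    orientedMove n (P.image (F.toLocal p)) (localSphere F p C) (F.toLocal p r) (F.toLocal p x) =
      F.toLocal p (orientedMove n P C r x) := by
  have hn0 : 0 < n := by omega
  have hA := h.isArc
  rw [orientedMove, orientedMove, freeRobots_image hn0, freePositions_image hn0,
    radialPoint_localSphere]
  by_cases h1 : freeRobots n P C r = ∅
  · simp only [h1, Finset.image_empty, if_true, toLocal_inj]
    split_ifs <;> rfl
  have hF := Finset.nonempty_iff_ne_empty.mpr h1
  obtain ⟨y, hy⟩ := id hF
  obtain ⟨z, hz⟩ := h.freePositions_nonempty hn hF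
  have hy' := h.ne_of_mem_freeRobots y hy
  have hz' := IsOriented.ne_of_mem_freePositions z hz
  have e1 : ∀ {arc arc' : Plane → Plane → ℝ},
      IsArc {x | dist x C.center = C.radius} arc →
      (∀ a b, arc' (F.toLocal p a) (F.toLocal p b) = arc a b) → _ := fun hA' =>
    hA'.next_image F p h.freeRobots_subset h.radialPoint_mem ⟨y, hy, hy'⟩
  have e2 : ∀ {arc arc' : Plane → Plane → ℝ},
      IsArc {x | dist x C.center = C.radius} arc →
      (∀ a b, arc' (F.toLocal p a) (F.toLocal p b) = arc a b) → _ := fun hA' =>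
    hA'.next_image F p h.freePositions_subset h.radialPoint_mem ⟨z, hz, hz'⟩
  have hiff := h.next_freePositions_eq_iff hn hF
  simp only [Finset.image_eq_empty, h1, if_false]
  change (if _ = next (cw (F.toLocal p C.center)) _ _ then next (cw (F.toLocal p C.center)) _ _
    else if _ = next (ccw (F.toLocal p C.center)) _ _ then next (ccw (F.toLocal p C.center)) _ _
    else _) = _
  rcases cw_toLocal F p with hcw | hcw
  · rw [e1 hA (hcw C.center), e2 hA (hcw C.center),
      e1 (arc' := ccw (F.toLocal p C.center)) hA.flip (fun a b => hcw C.center b a),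
      e2 (arc' := ccw (F.toLocal p C.center)) hA.flip (fun a b => hcw C.center b a)]
    simp only [toLocal_inj, apply_ite (F.toLocal p)]
    rfl
  · rw [e1 hA.flip (hcw C.center), e2 hA.flip (hcw C.center),
      e1 (arc' := ccw (F.toLocal p C.center)) hA (fun a b => hcw C.center b a),
      e2 (arc' := ccw (F.toLocal p C.center)) hA (fun a b => hcw C.center b a)]
    simp only [toLocal_inj, ← ccw_eq]
    split_ifs with h2 h3 h3
    -- A reversing frame tests the two directions in the opposite order. This matters only for a
    -- robot elected in both, whose two targets coincide.
    · rw [hiff.mpr (h3.symm.trans h2)]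
    all_goals rfl

/-! ### Destinations in global coordinates -/

/-- The destination, in global coordinates, of a robot at `p` with the frame `F`. -/
noncomputable def destination (A : Program) (F : Frame) (P : Finset Plane) (p : Plane) : Plane :=
  F.ofLocal p (A (P.image (F.toLocal p)))

theorem step_apply {n : ℕ} (A : Program) (F : Fin n → Frame) (S : Finset (Fin n))
    (pos : Fin n → Plane) (i : Fin n) :
    step A F S pos i = if i ∈ S then destination A (F i) (occupied pos) (pos i) else pos i := rfl

theorem destination_eq_of {A : Program} {F : Frame} {P : Finset Plane} {p x : Plane}
    (h : A (P.image (F.toLocal p)) = F.toLocal p x) : destination A F P p = x := by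
  rw [destination, h, ofLocal_toLocal]

theorem destination_eq_self {A : Program} {F : Frame} {P : Finset Plane} {p : Plane}
    (h : A (P.image (F.toLocal p)) = 0) : destination A F P p = p := by
  rw [destination, h, ofLocal_zero]

section PhiNgon

variable {n : ℕ} {ψ : Program} {F : Frame} {P : Finset Plane} {p : Plane}

theorem destination_of_isRegularNgon (hn : 3 ≤ n) (h : IsRegularNgon n P) :
    destination (phiNgon n ψ) F P p = p :=
  destination_eq_self (if_pos ((isRegularNgon_image hn F p).mpr h))

theorem destination_of_isOriented (hn : 5 ≤ n) {C : Sphere Plane} {r : Plane}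
    (h : IsOriented n P C r) :
    destination (phiNgon n ψ) F P p = orientedMove n P C r p := by
  apply destination_eq_of
  have h1 : ¬ IsRegularNgon n (P.image (F.toLocal p)) := fun h' =>
    h.not_isRegularNgon hn ((isRegularNgon_image (by omega) F p).mp h')
  have h2 : ∃ C r, IsOriented n (P.image (F.toLocal p)) C r :=
    (exists_isOriented_image F p).mpr ⟨C, r, h⟩
  -- Uniqueness identifies the arbitrarily chosen circle and robot with the images of `C` and `r`.
  obtain ⟨h3, h4⟩ := ((isOriented_localSphere F p).mpr h).unique hn h2.choose_spec.choose_spec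
  rw [phiNgon, if_neg h1, dif_pos h2, phiO_eq, ← h4, ← h3, ← orientedMove_image hn F p h,
    toLocal_self]

theorem destination_of_onCircle (hn : 5 ≤ n) {C : Sphere Plane} (h : OnCircle n P C)
    (hreg : ¬ IsRegularNgon n P) :
    destination (phiNgon n ψ) F P p =
      if IsLeader C.center P p then midpoint ℝ C.center p else p := by
  have h1 : ¬ IsRegularNgon n (P.image (F.toLocal p)) := fun h' =>
    hreg ((isRegularNgon_image (by omega) F p).mp h')
  have h2 : ¬ ∃ C r, IsOriented n (P.image (F.toLocal p)) C r := by
    rw [exists_isOriented_image]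
    rintro ⟨C', r', h'⟩
    exact h'.not_onCircle hn h
  have h3 : ∃ C, OnCircle n (P.image (F.toLocal p)) C := (exists_onCircle_image F p).mpr ⟨C, h⟩
  have h4 : h3.choose.center = F.toLocal p C.center := by
    rw [h3.choose_spec.unique (by omega) ((onCircle_localSphere F p).mpr h)]
    rfl
  apply destination_eq_of
  have h5 := isLeader_image F p (by omega) h (x := p)
  rw [toLocal_self] at h5
  rw [phiNgon, if_neg h1, dif_neg h2, dif_pos h3, h4, h5]
  split_ifs
  · rw [midpoint_eq_smul_add, midpoint_eq_smul_add, add_zero, Frame.toLocal, Frame.toLocal,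
      smul_comm, ← map_smul, invOf_eq_inv]
    congr 2
    module
  · rw [toLocal_self]

theorem destination_of_other (hn : 3 ≤ n) (h1 : ¬ IsRegularNgon n P)
    (h2 : ¬ ∃ C r, IsOriented n P C r) (h3 : ¬ ∃ C, OnCircle n P C) :
    destination (phiNgon n ψ) F P p = destination ψ F P p := by
  rw [destination, phiNgon, if_neg fun h' => h1 ((isRegularNgon_image hn F p).mp h'),
    dif_neg fun h' => h2 ((exists_isOriented_image F p).mp h'),
    dif_neg fun h' => h3 ((exists_onCircle_image F p).mp h'), destination]

end PhiNgon

/-! ### Runs -/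

theorem mem_occupied {n : ℕ} {pos : Fin n → Plane} {x : Plane} :
    x ∈ occupied pos ↔ ∃ i, pos i = x := by
  simp [occupied]

theorem card_occupied_eq_iff {n : ℕ} {pos : Fin n → Plane} :
    (occupied pos).card = n ↔ Function.Injective pos := by
  have := Finset.card_image_iff (s := (Finset.univ : Finset (Fin n))) (f := pos)
  rw [Finset.card_univ, Fintype.card_fin, Finset.coe_univ, Set.injOn_univ] at this
  exact this

/-- No two robots collide if those that move go to distinct unoccupied positions. -/
theorem injective_of_moves {n : ℕ} {pos pos' : Fin n → Plane} (hpos : Function.Injective pos)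
    (h1 : ∀ i, pos' i = pos i ∨ pos' i ∉ occupied pos)
    (h2 : ∀ i j, pos' i ≠ pos i → pos' j ≠ pos j → pos' i = pos' j → i = j) :
    Function.Injective pos' := by
  intro i j hij
  by_cases hi : pos' i = pos i
  · by_cases hj : pos' j = pos j
    · exact hpos (by rw [← hi, hij, hj])
    · exact absurd (mem_occupied.mpr ⟨i, by rw [← hi, hij]⟩) ((h1 j).resolve_left hj)
  · by_cases hj : pos' j = pos j
    · exact absurd (mem_occupied.mpr ⟨j, by rw [← hj, hij]⟩) ((h1 i).resolve_left hi)
    · exact h2 i j hi hj hij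

/-- Under a fair scheduler, the goal is reached if it is the only way out of an invariant, each
change of the configuration decreases a measure, and some robot changes the configuration when it
is active. -/
theorem exists_run_of_measure {n : ℕ} {A : Program} {F : Fin n → Frame}
    {sched : ℕ → Finset (Fin n)} {init : Fin n → Plane} (hfair : IsFair sched)
    (Inv Goal : (Fin n → Plane) → Prop) (μ : (Fin n → Plane) → ℕ)
    (hstep : ∀ pos, Inv pos → ¬ Goal pos → ∀ S, step A F S pos = pos ∨ Goal (step A F S pos) ∨
      (Inv (step A F S pos) ∧ μ (step A F S pos) < μ pos))
    (hmove : ∀ pos, Inv pos → ¬ Goal pos → ∃ i, ∀ S, i ∈ S → step A F S pos ≠ pos)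
    (t : ℕ) (ht : Inv (run A F sched init t)) : ∃ T, Goal (run A F sched init T) := by
  induction hm : μ (run A F sched init t) using Nat.strong_induction_on generalizing t with
  | _ m ih =>
    by_cases hgoal : Goal (run A F sched init t)
    · exact ⟨t, hgoal⟩
    obtain ⟨i, hi⟩ := hmove _ ht hgoal
    -- Were the configuration frozen, robot `i` would eventually be activated in it and change it.
    have hex : ∃ k, run A F sched init (t + k) ≠ run A F sched init t := by
      by_contra! hcon
      obtain ⟨s, hts, his⟩ := hfair.2 i t
      obtain ⟨k, rfl⟩ := Nat.exists_eq_add_of_le hts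
      have h1 : run A F sched init (t + (k + 1)) =
          step A F (sched (t + k)) (run A F sched init (t + k)) := rfl
      rw [hcon, hcon] at h1
      exact hi _ his h1.symm
    -- At the first change the step still starts from the configuration of time `t`, so `hstep`
    -- applies.
    obtain ⟨k, hk⟩ : ∃ k, Nat.find hex = k + 1 := Nat.exists_eq_succ_of_ne_zero (by
      intro h0
      have := Nat.find_spec hex
      rw [h0] at this
      exact this rfl)
    have hne := Nat.find_spec hex
    have heq : run A F sched init (t + k) = run A F sched init t :=
      not_not.mp (Nat.find_min hex (m := k) (by omega))
    have h1 : run A F sched init (t + (k + 1)) =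
        step A F (sched (t + k)) (run A F sched init (t + k)) := rfl
    rw [hk, h1, heq] at hne
    rw [heq] at h1
    rcases hstep _ ht hgoal (sched (t + k)) with h2 | h2 | ⟨h2, h3⟩
    · exact absurd h2 hne
    · exact ⟨t + (k + 1), by rw [h1]; exact h2⟩
    · rw [← h1] at h2 h3
      exact ih _ (hm ▸ h3) _ h2 rfl

/-! ### From an oriented configuration to a regular polygon -/

theorem orientedMove_cases {n : ℕ} {P : Finset Plane} {C : Sphere Plane} {r : Plane} (x : Plane)
    (hF : (freeRobots n P C r).Nonempty) :
    (x = next (cw C.center) (freeRobots n P C r) (radialPoint C r) ∧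
      orientedMove n P C r x = next (cw C.center) (freePositions n P C r) (radialPoint C r)) ∨
    (x = next (ccw C.center) (freeRobots n P C r) (radialPoint C r) ∧
      orientedMove n P C r x = next (ccw C.center) (freePositions n P C r) (radialPoint C r)) ∨
    orientedMove n P C r x = x := by
  rw [orientedMove, if_neg hF.ne_empty]
  split_ifs with h1 h2
  · exact Or.inl ⟨h1, rfl⟩
  · exact Or.inr (Or.inl ⟨h2, rfl⟩)
  · exact Or.inr (Or.inr rfl)

namespace IsOriented

variable {n : ℕ} {P : Finset Plane} {C : Sphere Plane} {r : Plane}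

theorem orientedMove_eq_or (h : IsOriented n P C r) (hn : 5 ≤ n) (x : Plane)
    (hF : (freeRobots n P C r).Nonempty) :
    orientedMove n P C r x = x ∨
      (x ∈ freeRobots n P C r ∧ orientedMove n P C r x ∈ freePositions n P C r) := by
  have hP := h.freePositions_nonempty hn hF
  rcases orientedMove_cases x hF with ⟨h1, h2⟩ | ⟨h1, h2⟩ | h1
  · rw [h2]
    right
    constructor
    · rw [h1]; exact next_mem _ h.ne_of_mem_freeRobots hF
    · exact next_mem _ ne_of_mem_freePositions hP
  · rw [h2]
    right
    constructor
    · rw [h1]; exact next_mem _ h.ne_of_mem_freeRobots hF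
    · exact next_mem _ ne_of_mem_freePositions hP
  · exact Or.inl h1

theorem orientedMove_inj (h : IsOriented n P C r) (hn : 5 ≤ n) {x y : Plane}
    (hF : (freeRobots n P C r).Nonempty) (hx : orientedMove n P C r x ≠ x)
    (hy : orientedMove n P C r y ≠ y) (hxy : orientedMove n P C r x = orientedMove n P C r y) :
    x = y := by
  have hiff := h.next_freePositions_eq_iff hn hF
  rcases orientedMove_cases x hF with ⟨h1, h2⟩ | ⟨h1, h2⟩ | h1
  · rcases orientedMove_cases y hF with ⟨h3, h4⟩ | ⟨h3, h4⟩ | h3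
    · rw [h1, h3]
    · rw [h1, h3]
      exact hiff.mp (by rw [← h2, hxy, h4])
    · exact absurd h3 hy
  · rcases orientedMove_cases y hF with ⟨h3, h4⟩ | ⟨h3, h4⟩ | h3
    · rw [h1, h3]
      exact (hiff.mp (by rw [← h4, ← hxy, h2])).symm
    · rw [h1, h3]
    · exact absurd h3 hy
  · exact absurd h1 hx

theorem orientedMove_next_ne (h : IsOriented n P C r) (hn : 5 ≤ n)
    (hF : (freeRobots n P C r).Nonempty) :
    orientedMove n P C r (next (cw C.center) (freeRobots n P C r) (radialPoint C r)) ≠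
      next (cw C.center) (freeRobots n P C r) (radialPoint C r) := by
  rw [orientedMove, if_neg hF.ne_empty, if_pos rfl]
  intro e
  have h1 := next_mem (cw C.center) h.ne_of_mem_freeRobots hF
  have h2 := next_mem (cw C.center) ne_of_mem_freePositions (h.freePositions_nonempty hn hF)
  rw [e] at h2
  exact (mem_freePositions.mp h2).2.2 (mem_freeRobots.mp h1).1

end IsOriented

theorem step_of_isOriented {n : ℕ} (hn : 5 ≤ n) {ψ : Program} {F : Fin n → Frame}
    {pos : Fin n → Plane} {C : Sphere Plane} {r : Plane} (h : IsOriented n (occupied pos) C r)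
    (S : Finset (Fin n)) (i : Fin n) :
    step (phiNgon n ψ) F S pos i =
      if i ∈ S then orientedMove n (occupied pos) C r (pos i) else pos i := by
  rw [step_apply, destination_of_isOriented hn h]

/-- Only free robots move, so `r` stays; they land on vertices of `C` other than `p₁`, so `C` and
`r` still witness the orientation. A mover leaves the set of free robots and nothing enters it,
whatever the active set `S`. -/
theorem IsOriented.step_of_nonempty {n : ℕ} (hn : 5 ≤ n) {ψ : Program} {F : Fin n → Frame}
    {pos : Fin n → Plane} {C : Sphere Plane} {r : Plane} (h : IsOriented n (occupied pos) C r)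
    (hF : (freeRobots n (occupied pos) C r).Nonempty) (S : Finset (Fin n))
    (hne : step (phiNgon n ψ) F S pos ≠ pos) :
    IsOriented n (occupied (step (phiNgon n ψ) F S pos)) C r ∧
      (freeRobots n (occupied (step (phiNgon n ψ) F S pos)) C r).card <
        (freeRobots n (occupied pos) C r).card := by
  have hinj := card_occupied_eq_iff.mp h.1
  set pos' := step (phiNgon n ψ) F S pos with hpos'
  have hmv : ∀ i, pos' i ≠ pos i → pos' i = orientedMove n (occupied pos) C r (pos i) := by
    intro i hi
    rw [hpos', step_of_isOriented hn h] at hi ⊢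
    split_ifs at hi ⊢
    · rfl
    · exact absurd rfl hi
  have hcase : ∀ i, pos' i = pos i ∨ (pos i ∈ freeRobots n (occupied pos) C r ∧
      pos' i ∈ freePositions n (occupied pos) C r) := by
    intro i
    by_cases hi : pos' i = pos i
    · exact Or.inl hi
    · right
      have h1 := h.orientedMove_eq_or hn (pos i) hF
      rw [← hmv i hi] at h1
      exact h1.resolve_left hi
  have hinj' : Function.Injective pos' := by
    refine injective_of_moves hinj (fun i => ?_) fun i j hi hj hij => ?_
    · exact (hcase i).imp_right fun h' => (mem_freePositions.mp h'.2).2.2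
    · have h1 := hmv i hi
      have h2 := hmv j hj
      exact hinj (h.orientedMove_inj hn hF (by rw [← h1]; exact hi) (by rw [← h2]; exact hj)
        (by rw [← h1, ← h2, hij]))
  have hr' : r ∈ occupied pos' := by
    obtain ⟨i, hi⟩ := mem_occupied.mp h.2.2.1
    refine mem_occupied.mpr ⟨i, ?_⟩
    rcases hcase i with h1 | h1
    · rw [h1, hi]
    · exact absurd hi (mem_freeRobots.mp h1.1).2.1
  refine ⟨⟨card_occupied_eq_iff.mpr hinj', h.2.1, hr', ?_, h.2.2.2.2.1, h.2.2.2.2.2.1, ?_⟩, ?_⟩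
  · intro x hx hxr
    obtain ⟨i, rfl⟩ := mem_occupied.mp hx
    rcases hcase i with h1 | h1
    · rw [h1] at hxr ⊢
      exact h.2.2.2.1 _ (mem_occupied.mpr ⟨i, rfl⟩) hxr
    · exact h.freePositions_subset _ h1.2
  · intro hx
    obtain ⟨i, hi⟩ := mem_occupied.mp hx
    rcases hcase i with h1 | h1
    · exact h.2.2.2.2.2.2 (mem_occupied.mpr ⟨i, h1.symm.trans hi⟩)
    · exact IsOriented.ne_of_mem_freePositions _ h1.2 hi
  · have hsub : ∀ i, pos' i ∈ freeRobots n (occupied pos') C r → pos' i = pos i := fun i hi =>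
      (hcase i).resolve_right fun h1 =>
        (mem_freeRobots.mp hi).2.2 (mem_freePositions.mp h1.2).1
    apply Finset.card_lt_card
    rw [Finset.ssubset_iff_of_subset]
    · obtain ⟨i, hi⟩ := Function.ne_iff.mp hne
      have h1 := (hcase i).resolve_left hi
      refine ⟨pos i, h1.1, fun h2 => ?_⟩
      obtain ⟨j, hj⟩ := mem_occupied.mp (mem_freeRobots.mp h2).1
      have h3 := hsub j (by rw [hj]; exact h2)
      rw [h3] at hj
      rw [hinj hj] at h3
      exact hi h3
    · intro x hx
      obtain ⟨i, rfl⟩ := mem_occupied.mp (mem_freeRobots.mp hx).1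
      have h1 := hsub i hx
      rw [mem_freeRobots, h1] at hx
      rw [h1]
      exact mem_freeRobots.mpr ⟨mem_occupied.mpr ⟨i, rfl⟩, hx.2⟩

/-- All robots but `r` are already at vertices, so a change means that `r` went to `p₁`; then `n`
distinct robots lie among `n` vertices. -/
theorem IsOriented.step_of_eq_empty {n : ℕ} (hn : 5 ≤ n) {ψ : Program} {F : Fin n → Frame}
    {pos : Fin n → Plane} {C : Sphere Plane} {r : Plane} (h : IsOriented n (occupied pos) C r)
    (hF : freeRobots n (occupied pos) C r = ∅) (S : Finset (Fin n))
    (hne : step (phiNgon n ψ) F S pos ≠ pos) :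
    IsRegularNgon n (occupied (step (phiNgon n ψ) F S pos)) := by
  have hn0 : 0 < n := by omega
  have hinj := card_occupied_eq_iff.mp h.1
  set pos' := step (phiNgon n ψ) F S pos with hpos'
  have hmv : ∀ i, pos' i = if i ∈ S then if pos i = r then radialPoint C r else pos i
      else pos i := by
    intro i
    rw [hpos', step_of_isOriented hn h, orientedMove, if_pos hF]
  have hcase : ∀ i, pos' i = pos i ∨ (pos i = r ∧ pos' i = radialPoint C r) := by
    intro i
    rw [hmv]
    split_ifs with h1 h2
    · exact Or.inr ⟨h2, rfl⟩
    · exact Or.inl rfl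
    · exact Or.inl rfl
  have hinj' : Function.Injective pos' := by
    refine injective_of_moves hinj (fun i => ?_) fun i j hi hj _ => ?_
    · refine (hcase i).imp_right fun h' => ?_
      rw [h'.2]
      exact h.2.2.2.2.2.2
    · exact hinj (((hcase i).resolve_left hi).1.trans ((hcase j).resolve_left hj).1.symm)
  obtain ⟨i₀, hi₀⟩ := Function.ne_iff.mp hne
  have h0 := (hcase i₀).resolve_left hi₀
  have hcard := card_finalPos hn0 h.2.1 h.radialPoint_mem
  have heq : occupied pos' = finalPos n C (radialPoint C r) := by
    refine Finset.eq_of_subset_of_card_le ?_ (by rw [hcard, card_occupied_eq_iff.mpr hinj'])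
    intro x hx
    obtain ⟨i, rfl⟩ := mem_occupied.mp hx
    by_cases hi : pos i = r
    · rw [hinj (hi.trans h0.1.symm), h0.2]
      exact self_mem_finalPos hn0 _ _
    · rw [(hcase i).resolve_right fun h' => hi h'.1]
      by_contra hnot
      have : pos i ∈ freeRobots n (occupied pos) C r :=
        mem_freeRobots.mpr ⟨mem_occupied.mpr ⟨i, rfl⟩, hi, hnot⟩
      rw [hF] at this
      exact Finset.notMem_empty _ this
  rw [heq]
  exact isRegularNgon_finalPos (by omega) h.2.1 h.radialPoint_mem hcard

theorem exists_isRegularNgon_of_isOriented {n : ℕ} (hn : 5 ≤ n) {ψ : Program}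
    {F : Fin n → Frame} {sched : ℕ → Finset (Fin n)} {init : Fin n → Plane}
    (hfair : IsFair sched) {t : ℕ} {C : Sphere Plane} {r : Plane}
    (h : IsOriented n (occupied (run (phiNgon n ψ) F sched init t)) C r) :
    ∃ T, IsRegularNgon n (occupied (run (phiNgon n ψ) F sched init T)) := by
  refine exists_run_of_measure hfair
    (fun pos => IsOriented n (occupied pos) C r) (fun pos => IsRegularNgon n (occupied pos))
    (fun pos => (freeRobots n (occupied pos) C r).card) ?_ ?_ t h
  · intro pos h _ S
    by_cases hne : step (phiNgon n ψ) F S pos = pos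
    · exact Or.inl hne
    right
    rcases Finset.eq_empty_or_nonempty (freeRobots n (occupied pos) C r) with hF | hF
    · exact Or.inl (h.step_of_eq_empty hn hF S hne)
    · exact Or.inr (h.step_of_nonempty hn hF S hne)
  · intro pos h _
    rcases Finset.eq_empty_or_nonempty (freeRobots n (occupied pos) C r) with hF | hF
    · obtain ⟨i, hi⟩ := mem_occupied.mp h.2.2.1
      refine ⟨i, fun S hS e => ?_⟩
      have h1 := congrFun e i
      rw [step_of_isOriented hn h, if_pos hS, orientedMove, if_pos hF, if_pos hi, hi] at h1
      refine h.2.2.2.2.2.2 ?_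
      rw [h1]
      exact h.2.2.1
    · obtain ⟨i, hi⟩ := mem_occupied.mp
        (mem_freeRobots.mp (next_mem (cw C.center) h.ne_of_mem_freeRobots hF)).1
      refine ⟨i, fun S hS e => ?_⟩
      have h1 := congrFun e i
      rw [step_of_isOriented hn h, if_pos hS, hi] at h1
      exact h.orientedMove_next_ne hn hF h1

/-! ### From a circle to an oriented configuration -/

/-- The leader is unique, so nobody else moves. It stops at half the radius, and its direction
points to the position it has just vacated. -/
theorem OnCircle.isOriented_step {n : ℕ} (hn : n.Prime) (hn5 : 5 ≤ n) {ψ : Program}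
    {F : Fin n → Frame} {pos : Fin n → Plane} {C : Sphere Plane} (h : OnCircle n (occupied pos) C)
    (hreg : ¬ IsRegularNgon n (occupied pos)) {i : Fin n}
    (hi : IsLeader C.center (occupied pos) (pos i)) (S : Finset (Fin n)) :
    (i ∉ S → step (phiNgon n ψ) F S pos = pos) ∧
    (i ∈ S → IsOriented n (occupied (step (phiNgon n ψ) F S pos)) C
      (midpoint ℝ C.center (pos i))) := by
  have hinj := card_occupied_eq_iff.mp h.1
  have huniq := existsUnique_isLeader hn hn5 h hreg
  have hmem : ∀ j, pos j ∈ occupied pos := fun j => mem_occupied.mpr ⟨j, rfl⟩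
  have hother : ∀ j, j ≠ i → step (phiNgon n ψ) F S pos j = pos j := by
    intro j hj
    rw [step_apply, destination_of_onCircle hn5 h hreg,
      if_neg fun h' => hj (hinj (huniq.unique h' hi)), ite_self]
  refine ⟨fun hiS => ?_, fun hiS => ?_⟩
  · ext1 j
    by_cases hj : j = i
    · subst hj
      rw [step_apply, if_neg hiS]
    · exact hother j hj
  · have hthis : step (phiNgon n ψ) F S pos i = midpoint ℝ C.center (pos i) := by
      rw [step_apply, if_pos hiS, destination_of_onCircle hn5 h hreg, if_pos hi]
    set pos' := step (phiNgon n ψ) F S pos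
    set m := midpoint ℝ C.center (pos i) with hm
    have hRi : dist (pos i) C.center = C.radius := h.2.2 _ (hmem i)
    have hd : dist m C.center = C.radius / 2 := by
      rw [hm, dist_midpoint_left, dist_comm, hRi]
      norm_num
      ring
    have hR := h.2.1
    have hmC : m ∉ C := fun h' => by
      rw [EuclideanGeometry.mem_sphere, hd] at h'
      linarith
    have hrad : radialPoint C m = pos i := by
      rw [radialPoint, hd, hm, midpoint_eq_smul_add, show C.radius / (C.radius / 2) = 2 by
        field_simp]
      simp only [invOf_eq_inv]
      module
    have hinj' : Function.Injective pos' := by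
      refine injective_of_moves hinj (fun j => ?_) fun j k hj hk _ => ?_
      · by_cases hj : j = i
        · subst hj
          rw [hthis]
          exact Or.inr fun h' => hmC (h.2.2 _ h')
        · exact Or.inl (hother j hj)
      · rw [not_imp_comm.mp (hother j) hj, not_imp_comm.mp (hother k) hk]
    refine ⟨card_occupied_eq_iff.mpr hinj', hR, mem_occupied.mpr ⟨i, hthis⟩, ?_, ?_, ?_, ?_⟩
    · intro x hx hxm
      obtain ⟨j, rfl⟩ := mem_occupied.mp hx
      by_cases hj : j = i
      · subst hj
        exact absurd hthis hxm
      · rw [hother j hj]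
        exact h.2.2 _ (hmem j)
    · rw [hd]
      linarith
    · rw [← dist_pos, hd]
      linarith
    · rw [hrad]
      intro hx
      obtain ⟨j, hj⟩ := mem_occupied.mp hx
      by_cases hji : j = i
      · subst hji
        rw [hthis] at hj
        exact hmC (hj ▸ h.2.2 _ (hmem j))
      · rw [hother j hji] at hj
        exact hji (hinj hj)

theorem exists_isRegularNgon_of_onCircle {n : ℕ} (hn : n.Prime) (hn5 : 5 ≤ n) {ψ : Program}
    {F : Fin n → Frame} {sched : ℕ → Finset (Fin n)} {init : Fin n → Plane}
    (hfair : IsFair sched) {t : ℕ} {C : Sphere Plane}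
    (h : OnCircle n (occupied (run (phiNgon n ψ) F sched init t)) C) :
    ∃ T, IsRegularNgon n (occupied (run (phiNgon n ψ) F sched init T)) := by
  by_cases hreg : IsRegularNgon n (occupied (run (phiNgon n ψ) F sched init t))
  · exact ⟨t, hreg⟩
  suffices h' : ∃ T, ∃ r, IsOriented n (occupied (run (phiNgon n ψ) F sched init T)) C r by
    obtain ⟨T, r, hT⟩ := h'
    exact exists_isRegularNgon_of_isOriented hn5 hfair hT
  -- A constant measure is enough: a step either changes nothing or produces an oriented
  -- configuration at once.
  refine exists_run_of_measure hfair
    (fun pos => OnCircle n (occupied pos) C ∧ ¬ IsRegularNgon n (occupied pos))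
    (fun pos => ∃ r, IsOriented n (occupied pos) C r) (fun _ => 0) ?_ ?_ t ⟨h, hreg⟩
  · rintro pos ⟨h, hreg⟩ _ S
    obtain ⟨r, hr, -⟩ := existsUnique_isLeader hn hn5 h hreg
    obtain ⟨i, rfl⟩ := mem_occupied.mp hr.mem
    by_cases hi : i ∈ S
    · exact Or.inr (Or.inl ⟨_, (h.isOriented_step hn hn5 hreg hr S).2 hi⟩)
    · exact Or.inl ((h.isOriented_step hn hn5 hreg hr S).1 hi)
  · rintro pos ⟨h, hreg⟩ _
    obtain ⟨r, hr, -⟩ := existsUnique_isLeader hn hn5 h hreg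
    obtain ⟨i, rfl⟩ := mem_occupied.mp hr.mem
    refine ⟨i, fun S hS e => ?_⟩
    have := (h.isOriented_step (ψ := ψ) (F := F) hn hn5 hreg hr S).2 hS
    rw [e] at this
    exact this.not_onCircle hn5 h

theorem run_eq_of_isRegularNgon {n : ℕ} (hn : 3 ≤ n) {ψ : Program}
    {F : Fin n → Frame} {sched : ℕ → Finset (Fin n)} {init : Fin n → Plane} {T : ℕ}
    (h : IsRegularNgon n (occupied (run (phiNgon n ψ) F sched init T))) {t : ℕ} (ht : T ≤ t) :
    run (phiNgon n ψ) F sched init t = run (phiNgon n ψ) F sched init T := by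
  induction t, ht using Nat.le_induction with
  | base => rfl
  | succ t _ ih =>
    rw [run, ih]
    ext1 i
    rw [step_apply, destination_of_isRegularNgon hn h, ite_self]

/-- If no regular polygon ever appears, neither does a circle or an oriented configuration, so the
run is literally that of `ψ`, which meets a circle. -/
theorem LeadsToCircle.solvesCircleFormation {n : ℕ} (hn : n.Prime) (hn5 : 5 ≤ n) {ψ : Program}
    (hψ : LeadsToCircle n ψ) : SolvesCircleFormation n (phiNgon n ψ) := by
  intro F sched init hfair hinit
  suffices h : ∃ T, IsRegularNgon n (occupied (run (phiNgon n ψ) F sched init T)) by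
    obtain ⟨T, hT⟩ := h
    exact ⟨T, hT, fun t ht => run_eq_of_isRegularNgon (by omega) hT ht⟩
  by_contra hreg
  have hor : ∀ t, ¬ ∃ C r, IsOriented n (occupied (run (phiNgon n ψ) F sched init t)) C r :=
    fun t ⟨_, _, h⟩ => hreg (exists_isRegularNgon_of_isOriented hn5 hfair h)
  have hci : ∀ t, ¬ ∃ C, OnCircle n (occupied (run (phiNgon n ψ) F sched init t)) C :=
    fun t ⟨_, h⟩ => hreg (exists_isRegularNgon_of_onCircle hn hn5 hfair h)
  have heq : ∀ t, run (phiNgon n ψ) F sched init t = run ψ F sched init t := by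
    intro t
    induction t with
    | zero => rfl
    | succ t ih =>
      rw [run, run, ← ih]
      ext1 i
      rw [step_apply, step_apply,
        destination_of_other (by omega) (fun h => hreg ⟨t, h⟩) (hor t) (hci t)]
  obtain ⟨t, ht⟩ := hψ F sched init hfair hinit
  rw [← heq] at ht
  exact hci t ht

/-! ### The smallest enclosing circle -/

/-- `C` is a smallest circle that encloses `P`. -/
def IsSEC (C : Sphere Plane) (P : Finset Plane) : Prop :=
  Encloses C P ∧ ∀ C', Encloses C' P → C.radius ≤ C'.radius

/-- The largest distance to a point of `P` is a continuous function of the centre that tends to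
infinity, so it attains its minimum. -/
theorem exists_isSEC {P : Finset Plane} (hP : P.Nonempty) : ∃ C, IsSEC C P := by
  obtain ⟨p, hp⟩ := id hP
  have hcont : Continuous fun c : Plane => P.sup' hP fun x => dist x c :=
    Continuous.finset_sup'_apply hP fun x _ => continuous_const.dist continuous_id
  have hlim : Filter.Tendsto (fun c : Plane => P.sup' hP fun x => dist x c)
      (Filter.cocompact Plane) Filter.atTop :=
    Filter.tendsto_atTop_mono (fun c => Finset.le_sup' (fun x => dist x c) hp)
      (tendsto_dist_left_cocompact_atTop p)
  obtain ⟨c, hc⟩ := hcont.exists_forall_le hlim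
  refine ⟨⟨c, P.sup' hP fun x => dist x c⟩, ⟨?_, fun x hx =>
    Finset.le_sup' (fun x => dist x c) hx⟩, ?_⟩
  · exact dist_nonneg.trans (Finset.le_sup' (fun x => dist x c) hp)
  · intro C' hC'
    exact (hc C'.center).trans (Finset.sup'_le hP _ hC'.2)

theorem IsSEC.not_forall_dist_lt {C : Sphere Plane} {P : Finset Plane} (h : IsSEC C P)
    (hP : P.Nonempty) (c : Plane) : ¬ ∀ x ∈ P, dist x c < C.radius := by
  intro hlt
  obtain ⟨p, hp⟩ := id hP
  have h1 := h.2 ⟨c, P.sup' hP fun x => dist x c⟩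
    ⟨dist_nonneg.trans (Finset.le_sup' (fun x => dist x c) hp), fun x hx =>
      Finset.le_sup' (fun x => dist x c) hx⟩
  exact absurd h1 (not_le.mpr ((Finset.sup'_lt_iff hP).mpr hlt))

/-- With two distinct centres, strict convexity of the norm would put all points at distance less
than the radius from their midpoint. -/
theorem IsSEC.unique {C C' : Sphere Plane} {P : Finset Plane} (h : IsSEC C P) (h' : IsSEC C' P)
    (hP : P.Nonempty) : C = C' := by
  have hr : C.radius = C'.radius := le_antisymm (h.2 C' h'.1) (h'.2 C h.1)
  suffices hc : C.center = C'.center from EuclideanGeometry.Sphere.ext hc hr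
  by_contra hne
  refine h.not_forall_dist_lt hP ((1 / 2 : ℝ) • C.center + (1 / 2 : ℝ) • C'.center) fun x hx => ?_
  have h1 := h.1.2 x hx
  have h2 := h'.1.2 x hx
  rw [dist_eq_norm] at h1 h2 ⊢
  rw [← hr] at h2
  have h3 := norm_combo_lt_of_ne h1 h2 (fun e => hne (sub_right_injective e))
    (a := 1 / 2) (b := 1 / 2) (by norm_num) (by norm_num) (by norm_num)
  rwa [show x - ((1 / 2 : ℝ) • C.center + (1 / 2 : ℝ) • C'.center) =
    (1 / 2 : ℝ) • (x - C.center) + (1 / 2 : ℝ) • (x - C'.center) by module]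

theorem isSEC_SEC {P : Finset Plane} (hP : P.Nonempty) : IsSEC (SEC P) P :=
  Classical.epsilon_spec (exists_isSEC hP)

/-- The smallest enclosing circle is determined by the points on it. -/
theorem IsSEC.radius_le {C C' : Sphere Plane} {P : Finset Plane} (h : IsSEC C P)
    (hP : P.Nonempty) (hC' : ∀ x ∈ P, x ∈ C → dist x C'.center ≤ C'.radius) :
    C.radius ≤ C'.radius := by
  by_contra! hlt
  -- Shift the centre slightly towards that of the smaller `C'`: points on `C` come closer by
  -- convexity, the others stay within the radius by continuity.
  have hev : ∀ x ∈ P, ∀ᶠ t : ℝ in nhdsWithin 0 (Set.Ioi 0),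
      dist x ((1 - t) • C.center + t • C'.center) < C.radius := by
    intro x hx
    by_cases hxC : x ∈ C
    · have h01 : ∀ᶠ t : ℝ in nhdsWithin 0 (Set.Ioi 0), t ∈ Set.Ioo (0 : ℝ) 1 :=
        Ioo_mem_nhdsGT one_pos
      filter_upwards [h01] with t ht
      have h1 : dist x C.center = C.radius := hxC
      have h2 := hC' x hx hxC
      calc dist x ((1 - t) • C.center + t • C'.center)
          = ‖(1 - t) • (x - C.center) + t • (x - C'.center)‖ := by
            rw [dist_eq_norm]
            congr 1
            module
        _ ≤ ‖(1 - t) • (x - C.center)‖ + ‖t • (x - C'.center)‖ := norm_add_le _ _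
        _ = (1 - t) * dist x C.center + t * dist x C'.center := by
            rw [norm_smul, norm_smul, dist_eq_norm, dist_eq_norm,
              Real.norm_of_nonneg (sub_nonneg.mpr ht.2.le), Real.norm_of_nonneg ht.1.le]
        _ < C.radius := by
            rw [h1]
            have := mul_lt_mul_of_pos_left (h2.trans_lt hlt) ht.1
            linarith
    · have h1 : dist x C.center < C.radius := lt_of_le_of_ne (h.1.2 x hx) hxC
      have h2 : Filter.Tendsto (fun t : ℝ => dist x ((1 - t) • C.center + t • C'.center))
          (nhds 0) (nhds (dist x ((1 - (0 : ℝ)) • C.center + (0 : ℝ) • C'.center))) :=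
        Continuous.tendsto (by fun_prop) 0
      rw [sub_zero, one_smul, zero_smul, add_zero] at h2
      exact (h2.mono_left nhdsWithin_le_nhds).eventually_lt_const h1
  obtain ⟨t, ht⟩ := ((Filter.eventually_all_finset P).mpr hev).exists
  exact h.not_forall_dist_lt hP _ ht

theorem IsSEC.of_support {C : Sphere Plane} {P P' : Finset Plane} (h : IsSEC C P)
    (hP : P.Nonempty) (hsub : ∀ x ∈ P, x ∈ C → x ∈ P') (hP' : ∀ x ∈ P', dist x C.center ≤ C.radius) :
    IsSEC C P' :=
  ⟨⟨h.1.1, hP'⟩, fun _ hC' => h.radius_le hP fun x hx hxC => hC'.2 x (hsub x hx hxC)⟩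

theorem encloses_localSphere (F : Frame) (p : Plane) {C : Sphere Plane} {P : Finset Plane} :
    Encloses (localSphere F p C) (P.image (F.toLocal p)) ↔ Encloses C P := by
  rw [Encloses, Encloses, Finset.forall_mem_image]
  simp only [localSphere, dist_toLocal, mul_le_mul_iff_right₀ F.unit_pos,
    mul_nonneg_iff_of_pos_left F.unit_pos]

theorem SEC_image (F : Frame) (p : Plane) {P : Finset Plane} (hP : P.Nonempty) :
    SEC (P.image (F.toLocal p)) = localSphere F p (SEC P) := by
  refine (isSEC_SEC (hP.image _)).unique ⟨?_, fun C' hC' => ?_⟩ (hP.image _)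
  · exact (encloses_localSphere F p).mpr (isSEC_SEC hP).1
  · obtain ⟨C, rfl⟩ := exists_localSphere_eq F p C'
    exact mul_le_mul_of_nonneg_left
      ((isSEC_SEC hP).2 C ((encloses_localSphere F p).mp hC')) F.unit_pos.le

/-! ### Placing the robots on a circle -/

/-- The robots strictly inside the smallest enclosing circle. -/
noncomputable def inside (P : Finset Plane) : Finset Plane :=
  P.filter fun x => dist x (SEC P).center < (SEC P).radius

theorem mem_inside {P : Finset Plane} {x : Plane} :
    x ∈ inside P ↔ x ∈ P ∧ dist x (SEC P).center < (SEC P).radius := Finset.mem_filter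

theorem inside_image (F : Frame) (p : Plane) {P : Finset Plane} (hP : P.Nonempty) :
    inside (P.image (F.toLocal p)) = (inside P).image (F.toLocal p) := by
  rw [inside, SEC_image F p hP, Finset.filter_image, inside]
  simp only [localSphere, dist_toLocal, mul_lt_mul_iff_right₀ F.unit_pos]

theorem candidate_start_mem {C : Sphere Plane} (hC : 0 ≤ C.radius) :
    dist (if C.center = 0 then (C.radius : ℂ) else radialPoint C 0) C.center = C.radius := by
  split_ifs with h
  · rw [h, dist_zero_right, Complex.norm_of_nonneg hC]
  · have hd : dist 0 C.center ≠ 0 := dist_ne_zero.mpr (Ne.symm h)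
    rw [radialPoint, dist_eq_norm, add_sub_cancel_left, norm_smul, ← dist_eq_norm,
      Real.norm_of_nonneg (div_nonneg hC dist_nonneg), div_mul_cancel₀ _ hd]

theorem candidate_mem {C : Sphere Plane} (hC : 0 ≤ C.radius) (k : ℕ) : candidate C k ∈ C := by
  rw [EuclideanGeometry.mem_sphere, candidate]
  rw [dist_eq_norm, add_sub_cancel_left, norm_mul, Complex.norm_exp_ofReal_mul_I, one_mul,
    ← dist_eq_norm, candidate_start_mem hC]

theorem candidate_succ (C : Sphere Plane) (k : ℕ) :
    candidate C (k + 1) = C.center + Complex.exp (((1 / (k + 1) : ℝ) : ℂ) * Complex.I) *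
      ((if C.center = 0 then (C.radius : ℂ) else radialPoint C 0) - C.center) := by
  simp [candidate]

/-- The angles `1 / (k + 1)` are distinct and lie in `(0, 1]`, within one period of `exp`; hence
finitely many robots cannot block all candidates. -/
theorem candidate_succ_injective {C : Sphere Plane} (hC : 0 < C.radius) :
    Function.Injective fun k => candidate C (k + 1) := by
  intro j k hjk
  have h0 : (if C.center = 0 then (C.radius : ℂ) else radialPoint C 0) - C.center ≠ 0 := by
    rw [← norm_pos_iff, ← dist_eq_norm, candidate_start_mem hC.le]
    exact hC
  simp only [candidate_succ, add_right_inj] at hjk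
  have h1 := mul_right_cancel₀ h0 hjk
  have hb : ∀ m : ℕ, 0 < (1 / (m + 1) : ℝ) ∧ (1 / (m + 1) : ℝ) ≤ 1 := fun m =>
    ⟨Nat.one_div_pos_of_nat, by rw [div_le_one (by positivity)]; simp⟩
  have hpi := Real.pi_gt_three
  have h2 := Complex.exp_inj_of_neg_pi_lt_of_le_pi
    (by rw [Complex.mul_I_im, Complex.ofReal_re]; linarith [(hb j).1])
    (by rw [Complex.mul_I_im, Complex.ofReal_re]; linarith [(hb j).2])
    (by rw [Complex.mul_I_im, Complex.ofReal_re]; linarith [(hb k).1])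
    (by rw [Complex.mul_I_im, Complex.ofReal_re]; linarith [(hb k).2]) h1
  have h3 := Complex.ofReal_injective (mul_right_cancel₀ Complex.I_ne_zero h2)
  rw [one_div, one_div, inv_inj] at h3
  exact_mod_cast add_right_cancel h3

theorem tendsto_candidate (C : Sphere Plane) :
    Filter.Tendsto (fun k => candidate C (k + 1)) Filter.atTop
      (nhds (if C.center = 0 then (C.radius : ℂ) else radialPoint C 0)) := by
  simp only [candidate_succ]
  set s := if C.center = 0 then (C.radius : ℂ) else radialPoint C 0
  have h1 : Filter.Tendsto (fun θ : ℝ => C.center + Complex.exp ((θ : ℂ) * Complex.I) *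
      (s - C.center)) (nhds 0)
      (nhds (C.center + Complex.exp (((0 : ℝ) : ℂ) * Complex.I) * (s - C.center))) :=
    Continuous.tendsto (by fun_prop) 0
  have h2 := h1.comp tendsto_one_div_add_atTop_nhds_zero_nat
  rw [Complex.ofReal_zero, zero_mul, Complex.exp_zero, one_mul, add_sub_cancel] at h2
  exact h2

/-- The point of the circle in the direction of an inner robot that is farthest from the centre is
closer to that robot than to any other inner robot. -/
theorem inCell_candidate_start {Q : Finset Plane} {C : Sphere Plane} (h0 : dist 0 C.center < C.radius)
    (hmax : ∀ x ∈ Q, dist x C.center ≤ dist 0 C.center) :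
    InCell Q (if C.center = 0 then (C.radius : ℂ) else radialPoint C 0) := by
  intro x hx hx0
  have hR : 0 < C.radius := dist_nonneg.trans_lt h0
  have hs := candidate_start_mem hR.le
  have hxd := hmax x hx
  split_ifs at hs ⊢ with h
  -- If the farthest robot stands at the centre, there is no other inner robot.
  · rw [h, dist_self] at hxd
    exact absurd (dist_le_zero.mp hxd) hx0
  set s := radialPoint C 0 with hsdef
  have hd : 0 < dist 0 C.center := dist_pos.mpr (Ne.symm h)
  have hsd : dist s 0 = C.radius - dist 0 C.center := by
    have h1 : s = (1 - C.radius / dist 0 C.center) • C.center := by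
      rw [hsdef, radialPoint]
      module
    have h2 : 1 < C.radius / dist 0 C.center := (one_lt_div hd).mpr h0
    rw [dist_zero_right, h1, norm_smul, Real.norm_of_nonpos (by linarith), ← dist_zero_left,
      neg_mul, sub_mul, div_mul_cancel₀ _ hd.ne']
    ring
  rw [hsd]
  -- A competitor at least as close to `s` gives equality in the triangle inequality, so it lies on
  -- the radius to `s` at the same distance from the centre as `0`, and is `0`.
  by_contra! hle
  have htri := dist_triangle C.center x s
  rw [dist_comm C.center s, hs, dist_comm C.center x, dist_comm x s] at htri
  have hxe : dist x C.center = dist 0 C.center := by linarith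
  have hw : Wbtw ℝ C.center x s := by
    rw [← dist_add_dist_eq_iff, dist_comm C.center s, hs, dist_comm C.center x, dist_comm x s]
    linarith
  obtain ⟨t, ⟨ht0, -⟩, rfl⟩ := hw
  rw [dist_lineMap_left, Real.norm_of_nonneg ht0, dist_comm, hs] at hxe
  apply hx0
  rw [AffineMap.lineMap_apply, hsdef, radialPoint, vsub_eq_sub, vadd_eq_add, add_sub_cancel_left,
    smul_smul, ← mul_div_assoc, hxe, div_self hd.ne', one_smul]
  ring

/-- The unrotated point lies in the cell, an open condition, but may be occupied. The rotated ones
converge to it and are pairwise distinct, so late ones are in the cell and unoccupied. -/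
theorem exists_candidate {P Q : Finset Plane} {C : Sphere Plane} (h0 : dist 0 C.center < C.radius)
    (hmax : ∀ x ∈ Q, dist x C.center ≤ dist 0 C.center) :
    ∃ k, candidate C k ∉ P ∧ InCell Q (candidate C k) := by
  have hR : 0 < C.radius := dist_nonneg.trans_lt h0
  have hlim := tendsto_candidate C
  have hcell := inCell_candidate_start h0 hmax
  have h1 : ∀ᶠ k in Filter.atTop, candidate C (k + 1) ∉ P := by
    rw [← Nat.cofinite_eq_atTop]
    exact (candidate_succ_injective hR).tendsto_cofinite.eventually
      P.finite_toSet.compl_mem_cofinite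
  have h2 : ∀ᶠ k in Filter.atTop, ∀ x ∈ Q, x ≠ 0 →
      dist (candidate C (k + 1)) 0 < dist (candidate C (k + 1)) x := by
    rw [Filter.eventually_all_finset]
    intro x hx
    by_cases hx0 : x = 0
    · exact Filter.Eventually.of_forall fun _ h => absurd hx0 h
    · filter_upwards [(hlim.dist tendsto_const_nhds).eventually_lt (hlim.dist tendsto_const_nhds)
        (hcell x hx hx0)] with k hk _
      exact hk
  obtain ⟨k, hk1, hk2⟩ := (h1.and h2).exists
  exact ⟨k + 1, hk1, hk2⟩

theorem phiCircle_of_exists {Q : Finset Plane} (h0 : 0 ∈ inside Q)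
    (h : ∃ k, candidate (SEC Q) k ∉ Q ∧ InCell (inside Q) (candidate (SEC Q) k)) :
    phiCircle Q = candidate (SEC Q) (Nat.find h) :=
  (if_neg (not_not.mpr h0)).trans (dif_pos h)

theorem phiCircle_eq_or {Q : Finset Plane} (hQ : Q.Nonempty) :
    phiCircle Q = 0 ∨ (0 ∈ inside Q ∧ phiCircle Q ∈ SEC Q ∧ phiCircle Q ∉ Q ∧
      InCell (inside Q) (phiCircle Q)) := by
  by_cases h1 : 0 ∈ inside Q
  · by_cases h2 : ∃ k, candidate (SEC Q) k ∉ Q ∧ InCell (inside Q) (candidate (SEC Q) k)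
    · right
      rw [phiCircle_of_exists h1 h2]
      exact ⟨h1, candidate_mem (isSEC_SEC hQ).1.1 _, Nat.find_spec h2⟩
    · exact Or.inl ((if_neg (not_not.mpr h1)).trans (dif_neg h2))
  · exact Or.inl (if_pos h1)

theorem phiCircle_ne_zero {Q : Finset Plane} (h0 : 0 ∈ inside Q)
    (hmax : ∀ x ∈ inside Q, dist x (SEC Q).center ≤ dist 0 (SEC Q).center) :
    phiCircle Q ≠ 0 := by
  have h1 := mem_inside.mp h0
  have h2 := exists_candidate (P := Q) h1.2 hmax
  rw [phiCircle_of_exists h0 h2]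
  exact fun e => (Nat.find_spec h2).1 (e ▸ h1.1)

theorem destination_phiCircle (F : Frame) {P : Finset Plane} {p : Plane} (hp : p ∈ P) :
    destination phiCircle F P p = p ∨ (p ∈ inside P ∧ destination phiCircle F P p ∈ SEC P ∧
      destination phiCircle F P p ∉ P ∧ ∀ x ∈ inside P, x ≠ p →
        dist (destination phiCircle F P p) p < dist (destination phiCircle F P p) x) := by
  have hP : P.Nonempty := ⟨p, hp⟩
  obtain ⟨d, hd⟩ : ∃ d, F.toLocal p d = phiCircle (P.image (F.toLocal p)) :=
    ⟨_, toLocal_ofLocal F p _⟩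
  rw [destination_eq_of hd.symm]
  rcases phiCircle_eq_or (hP.image (F.toLocal p)) with h | ⟨h1, h2, h3, h4⟩
  · left
    rw [← hd, ← toLocal_self F p, toLocal_inj] at h
    exact h
  · right
    rw [← hd] at h2 h3 h4
    rw [inside_image F p hP] at h1 h4
    rw [SEC_image F p hP] at h2
    refine ⟨?_, (toLocal_mem_localSphere F p).mp h2, (toLocal_mem_image F p).not.mp h3, ?_⟩
    · rw [← toLocal_self F p, toLocal_mem_image] at h1
      exact h1
    · intro x hx hxp
      have h5 := h4 _ ((toLocal_mem_image F p).mpr hx)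
      rw [← toLocal_self F p, dist_toLocal, dist_toLocal, mul_lt_mul_iff_right₀ F.unit_pos] at h5
      exact h5 fun e => hxp ((toLocal_inj F p).mp e)

theorem destination_phiCircle_ne (F : Frame) {P : Finset Plane} {p : Plane} (hp : p ∈ inside P)
    (hmax : ∀ x ∈ inside P, dist x (SEC P).center ≤ dist p (SEC P).center) :
    destination phiCircle F P p ≠ p := by
  have hP : P.Nonempty := ⟨p, (mem_inside.mp hp).1⟩
  intro e
  have h1 : phiCircle (P.image (F.toLocal p)) ≠ 0 := by
    apply phiCircle_ne_zero
    · rw [inside_image F p hP, ← toLocal_self F p, toLocal_mem_image]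
      exact hp
    · rw [inside_image F p hP, SEC_image F p hP, Finset.forall_mem_image]
      intro x hx
      rw [← toLocal_self F p, localSphere, dist_toLocal, dist_toLocal]
      exact mul_le_mul_of_nonneg_left (hmax x hx) F.unit_pos.le
  have h2 := toLocal_ofLocal F p (phiCircle (P.image (F.toLocal p)))
  rw [destination] at e
  rw [e, toLocal_self] at h2
  exact h1 h2.symm

/-- Open Voronoi cells are disjoint, so movers have distinct targets. The robots on the smallest
enclosing circle stay and the movers land on it, so the circle persists and each mover leaves
`inside`. -/
theorem step_phiCircle {n : ℕ} {F : Fin n → Frame} {pos : Fin n → Plane}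
    (hinj : Function.Injective pos) (S : Finset (Fin n)) (hne : step phiCircle F S pos ≠ pos) :
    Function.Injective (step phiCircle F S pos) ∧
      (inside (occupied (step phiCircle F S pos))).card < (inside (occupied pos)).card := by
  have hmem : ∀ i, pos i ∈ occupied pos := fun i => mem_occupied.mpr ⟨i, rfl⟩
  have hcase : ∀ i, step phiCircle F S pos i = pos i ∨ (pos i ∈ inside (occupied pos) ∧
      step phiCircle F S pos i ∈ SEC (occupied pos) ∧
      step phiCircle F S pos i ∉ occupied pos ∧ ∀ x ∈ inside (occupied pos), x ≠ pos i →
        dist (step phiCircle F S pos i) (pos i) < dist (step phiCircle F S pos i) x) := by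
    intro i
    rw [step_apply]
    split_ifs
    · exact destination_phiCircle (F i) (hmem i)
    · exact Or.inl rfl
  set pos' := step phiCircle F S pos
  obtain ⟨i₀, hi₀⟩ := Function.ne_iff.mp hne
  have hP : (occupied pos).Nonempty := ⟨_, hmem i₀⟩
  have hP' : (occupied pos').Nonempty := ⟨_, mem_occupied.mpr ⟨i₀, rfl⟩⟩
  have hinj' : Function.Injective pos' := by
    refine injective_of_moves hinj (fun i => (hcase i).imp_right fun h => h.2.2.1)
      fun i j hi hj hij => ?_
    obtain ⟨h1, -, -, h2⟩ := (hcase i).resolve_left hi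
    obtain ⟨h3, -, -, h4⟩ := (hcase j).resolve_left hj
    by_contra hne
    have h5 := h2 _ h3 fun e => hne (hinj e).symm
    have h6 := h4 _ h1 fun e => hne (hinj e)
    rw [hij] at h5
    exact lt_asymm h5 h6
  have hSEC : SEC (occupied pos') = SEC (occupied pos) := by
    refine (isSEC_SEC hP').unique ((isSEC_SEC hP).of_support hP ?_ ?_) hP'
    · intro x hx hxC
      obtain ⟨i, rfl⟩ := mem_occupied.mp hx
      refine mem_occupied.mpr ⟨i, (hcase i).resolve_right fun h => ?_⟩
      exact (mem_inside.mp h.1).2.ne hxC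
    · intro x hx
      obtain ⟨i, rfl⟩ := mem_occupied.mp hx
      rcases hcase i with h | h
      · rw [h]
        exact (isSEC_SEC hP).1.2 _ (hmem i)
      · exact le_of_eq h.2.1
  refine ⟨hinj', ?_⟩
  have hsub : ∀ i, pos' i ∈ inside (occupied pos') → pos' i = pos i := fun i hi =>
    (hcase i).resolve_right fun h => by
      have h1 := (mem_inside.mp hi).2
      rw [hSEC] at h1
      exact h1.ne h.2.1
  apply Finset.card_lt_card
  rw [Finset.ssubset_iff_of_subset]
  · refine ⟨pos i₀, ((hcase i₀).resolve_left hi₀).1, fun h => ?_⟩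
    obtain ⟨j, hj⟩ := mem_occupied.mp (mem_inside.mp h).1
    have h3 := hsub j (by rw [hj]; exact h)
    rw [h3] at hj
    rw [hinj hj] at h3
    exact hi₀ h3
  · intro x hx
    obtain ⟨i, rfl⟩ := mem_occupied.mp (mem_inside.mp hx).1
    have h1 := hsub i hx
    rw [mem_inside, hSEC, h1] at hx
    rw [h1]
    exact mem_inside.mpr ⟨hmem i, hx.2⟩

theorem onCircle_of_inside_eq_empty {n : ℕ} (hn : 2 ≤ n) {P : Finset Plane} (hP : P.card = n)
    (h : inside P = ∅) : OnCircle n P (SEC P) := by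
  have hP1 : 1 < P.card := by omega
  obtain ⟨a, ha, b, hb, hab⟩ := Finset.one_lt_card.mp hP1
  have hS := isSEC_SEC ⟨a, ha⟩
  refine ⟨hP, lt_of_le_of_ne hS.1.1 fun h0 => hab ?_, fun x hx => ?_⟩
  · have h1 := hS.1.2 a ha
    have h2 := hS.1.2 b hb
    rw [← h0] at h1 h2
    rw [dist_le_zero.mp h1, dist_le_zero.mp h2]
  · by_contra hx'
    have : x ∈ inside P := mem_inside.mpr ⟨hx, lt_of_le_of_ne (hS.1.2 x hx) hx'⟩
    rw [h] at this
    exact Finset.notMem_empty _ this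

theorem leadsToCircle_phiCircle {n : ℕ} (hn : 2 ≤ n) : LeadsToCircle n phiCircle := by
  intro F sched init hfair hinit
  refine exists_run_of_measure hfair Function.Injective
    (fun pos => ∃ C, OnCircle n (occupied pos) C) (fun pos => (inside (occupied pos)).card)
    ?_ ?_ 0 hinit
  · intro pos hpos _ S
    by_cases hne : step phiCircle F S pos = pos
    · exact Or.inl hne
    · exact Or.inr (Or.inr (step_phiCircle hpos S hne))
  · intro pos hpos hgoal
    have hin : (inside (occupied pos)).Nonempty := by
      rw [Finset.nonempty_iff_ne_empty]
      intro h
      exact hgoal ⟨_, onCircle_of_inside_eq_empty hn (card_occupied_eq_iff.mpr hpos) h⟩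
    -- The inner robot farthest from the centre is the one that is guaranteed to move when
    -- activated.
    obtain ⟨p, hp, hmax⟩ := Finset.exists_max_image _
      (fun x => dist x (SEC (occupied pos)).center) hin
    obtain ⟨i, rfl⟩ := mem_occupied.mp (mem_inside.mp hp).1
    refine ⟨i, fun S hS e => destination_phiCircle_ne (F i) hp hmax ?_⟩
    have h1 := congrFun e i
    rwa [step_apply, if_pos hS] at h1

end CircleFormation

theorem mainTheorem1 (n : ℕ) (hprime : n.Prime) (hn : 5 ≤ n) :
    CircleFormation.SolvesCircleFormation n
        (CircleFormation.phiNgon n CircleFormation.phiCircle) ∧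
      ∀ ψ : CircleFormation.Program, CircleFormation.LeadsToCircle n ψ →
        CircleFormation.SolvesCircleFormation n (CircleFormation.phiNgon n ψ) :=
  ⟨(CircleFormation.leadsToCircle_phiCircle (by omega)).solvesCircleFormation hprime hn,
    fun _ hψ => hψ.solvesCircleFormation hprime hn⟩
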